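/- **Setting.** Let $f:\mathbb R^n\to\mathbb R$, $h=(h_1,\dots,h_{m_1})$ and $c=(c_1,\dots,c_{m_2})$ be continuously differentiable functions on $\mathbb R^n$, and consider $\min f(x)$ subject to $h(x)=0$, $c(x)\le 0$. Let $\|\cdot\|$ be the Euclidean norm, $K=\{0\}\times\mathbb R_-^{m_2}\subset\mathbb R^{m_1+m_2}$, and let $\mathrm{dist}(\cdot\mid K)$ be the $\ell_\infty$ distance to $K$. Put $$\phi(x)=\mathrm{dist}\big((h(x),c(x))\mid K\big),\qquad \kappa(x,\sigma)=\inf_{\|p\|_\infty\le\sigma}\mathrm{dist}\big((h(x)+\nabla h(x)^Tp,\ c(x)+\nabla c(x)^Tp)\mid K\big),$$ $\Delta_\phi(x,\sigma)=\phi(x)-\kappa(x,\sigma)$, and $$\chi(x)=-\min\{\nabla f(x)^Tt:\ \nabla h(x)^Tt=0,\ \nabla c(x)^Tt\le 0,\ \|t\|_\infty\le\tfrac12\beta_l\}.$$ **Algorithm (stochastic SQP).** Parameters: $0<2\sigma_u<\beta_l<\beta_u$, $\kappa_u>0$, $\gamma>1$, $\theta\in(0,1)$, $\alpha_{\max}>0$,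 $\rho_0>0$, $p_f\in(0,1]$, $p_0^g>0$, $\zeta_0,\zeta_c>0$, a nondecreasing sequence $a_j\in(0,1)$ with $a_0\ge p_0^g$ and $\sum_j(1-a_j)<\infty$, a starting point $x_0$, and $\alpha_0=\gamma^{j_0}\alpha_{\max}$ with an integer $j_0<0$; set $j=1$. At iteration $k=0,1,2,\dots$: * Let $\sigma_k=\min\{\sigma_u,\kappa_u\phi(x_k)\}$ and $\kappa_k=\kappa(x_k,\sigma_k)$; choose $\beta_k\in[\beta_l,\beta_u]$ and a matrix $H_k$ (with $H_k=H_{k-1}$ if $k\ge1$ and $x_k=x_{k-1}$), both determined by the past. Compute a random gradient estimate $g_k$, and let $d_k$ minimize $g_k^Td+\frac12d^TH_kd$ subject to $-\kappa_ke\le h(x_k)+\nabla h(x_k)^Td\le\kappa_ke$, $c(x_k)+\nabla c(x_k)^Td\le\kappa_ke$, $\|d\|_\infty\le\beta_k$, where $e$ is the vector of ones. * If $\|g_k\|>\zeta_k$, set $\zeta_{k+1}=\max\{\zeta_k+\zeta_c,\|g_k\|\}$, $p^g_{k+1}=a_j$ and then $j\leftarrow j+1$; otherwise set $\zeta_{k+1}=\zeta_k$,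 $p^g_{k+1}=p^g_k$. * Let $\Delta_k(\rho)=-g_k^Td_k+\rho\,\Delta_\phi(x_k,\sigma_k)$. If $\Delta_k(\rho_k)\ge\frac12d_k^TH_kd_k$, set $\rho_{k+1}=\rho_k$; otherwise set $\rho_{k+1}=\max\{(g_k^Td_k+\frac12d_k^TH_kd_k)/\Delta_\phi(x_k,\sigma_k),\,2\rho_k\}$. * Compute random estimates $f_k^0$ of $f(x_k)$ and $f_k^s$ of $f(x_k+\alpha_kd_k)$. If $f_k^0+\rho_{k+1}\phi(x_k)-f_k^s-\rho_{k+1}\phi(x_k+\alpha_kd_k)\ge\theta\alpha_k\Delta_k(\rho_{k+1})$, set $x_{k+1}=x_k+\alpha_kd_k$ and $\alpha_{k+1}=\min\{\gamma\alpha_k,\alpha_{\max}\}$; otherwise set $x_{k+1}=x_k$ and $\alpha_{k+1}=\gamma^{-1}\alpha_k$. Let $\mathcal F_{k-1}$ be the $\sigma$-algebra generated by $g_i,f_i^0,f_i^s$ for $i<k$, and let $\mathcal F_{k-1/2}$ be generated by $\mathcal F_{k-1}$ and $g_k$. **Assumptions.** 1. (A1)–(A4): There is a bounded closed set $\Omega$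 that almost surely contains all iterates $x_k$ and all trial points $x_k+\alpha d_k$, $0\le\alpha\le\alpha_k$. On $\Omega$, $f$ is bounded below, $h$, $c$ and their gradients are bounded, and $\nabla f$, $\nabla h_i$, $\nabla c_j$ are Lipschitz continuous. There are constants $\xi,M_H>0$ such that almost surely $2\xi\|d\|^2\le d^TH_kd\le M_H\|d\|^2$ for all $k$ and all $d\in\mathbb R^n$. 2. (Probabilistic accuracy): For some $\kappa_g>0$ and $0<\varepsilon_f<\frac{\xi\theta}{4\alpha_{\max}}$, the events $I_k=\{\|g_k-\nabla f(x_k)\|\le\kappa_g\alpha_k\|d_k\|\}$ and $J_k=\{|f_k^0-f(x_k)|\le\varepsilon_f\alpha_k^2\|d_k\|^2\text{ and }|f_k^s-f(x_k+\alpha_kd_k)|\le\varepsilon_f\alpha_k^2\|d_k\|^2\}$ satisfy, almost surely for all $k$, $\Pr(I_k\mid\mathcal F_{k-1})\ge p_k^g$ and $\Pr(J_k\mid\mathcal F_{k-1/2})\ge p_f$. The probabilities are large enough that $p_f\,p_0^g>\frac12$. 3. (eMFCQ): Almost surely, every accumulation point $x$ of $\{x_k\}$ satisfies the extended MFCQ: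 the gradients $\nabla h_i(x)$ are linearly independent, and there is $z\in\mathbb R^n$ with $\nabla h(x)^Tz=0$ and $\nabla c_i(x)^Tz<0$ for all $i$ with $c_i(x)\ge0$. 4. (Variance condition): For some $\kappa_f>0$ and all $k$, the squared errors $|f_k^s-f(x_k+\alpha_kd_k)|^2$ and $|f_k^0-f(x_k)|^2$ are integrable, and their conditional expectations given $\mathcal F_{k-1/2}$ are almost surely at most $\kappa_f^2\alpha_k^2(\phi(x_k)^2+\chi(x_k)^2)^2$. **Claim.** Almost surely, on the event that the sequence of gradient estimates $\{g_k\}$ or the sequence of penalty parameters $\{\rho_k\}$ is bounded, $$\liminf_{k\to\infty}\ \big(\phi(x_k)^2+\chi(x_k)^2\big)=0 .$$ -/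

import Mathlib

open MeasureTheory Filter
open scoped Gradient RealInnerProductSpace

namespace StochSQP

noncomputable section

/-- `ℝⁿ` with the Euclidean norm. -/
abbrev Vec (n : ℕ) : Type := EuclideanSpace ℝ (Fin n)

/-- The `ℓ∞` norm on `ℝⁿ`. -/
def supNorm {n : ℕ} (p : Vec n) : ℝ := ‖WithLp.ofLp p‖

/-- The quadratic form `dᵀ H d`. -/
def quadForm {n : ℕ} (H : Matrix (Fin n) (Fin n) ℝ) (d : Vec n) : ℝ :=
  WithLp.ofLp d ⬝ᵥ H.mulVec (WithLp.ofLp d)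

/-- The data of `min f(x)` subject to `h(x) = 0`, `c(x) ≤ 0`. -/
structure Problem (n m₁ m₂ : ℕ) where
  f : Vec n → ℝ
  h : Fin m₁ → Vec n → ℝ
  c : Fin m₂ → Vec n → ℝ

/-- `K = {0} × ℝ₋^{m₂}`; the ambient product carries the `ℓ∞` metric. -/
def coneK (m₁ m₂ : ℕ) : Set ((Fin m₁ → ℝ) × (Fin m₂ → ℝ)) :=
  {y | y.1 = 0 ∧ ∀ j, y.2 j ≤ 0}

namespace Problem

variable {n m₁ m₂ : ℕ} (P : Problem n m₁ m₂)

/-- Infeasibility `φ(x)`: the `ℓ∞` distance of `(h(x), c(x))` to `K`. -/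
def phi (x : Vec n) : ℝ :=
  Metric.infDist ((fun i => P.h i x), (fun j => P.c j x)) (coneK m₁ m₂)

/-- Infeasibility of the constraints linearized at `x`, for the step `p`. -/
def linPhi (x p : Vec n) : ℝ :=
  Metric.infDist ((fun i => P.h i x + ⟪∇ (P.h i) x, p⟫), (fun j => P.c j x + ⟪∇ (P.c j) x, p⟫))
    (coneK m₁ m₂)

/-- `κ(x, σ)`: the least linearized infeasibility over `‖p‖_∞ ≤ σ`. -/
def kappa (x : Vec n) (σ : ℝ) : ℝ :=
  sInf (P.linPhi x '' {p | supNorm p ≤ σ})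

/-- `Δ_φ(x, σ) = φ(x) - κ(x, σ)`. -/
def deltaPhi (x : Vec n) (σ : ℝ) : ℝ := P.phi x - P.kappa x σ

/-- The feasible set of the quadratic subproblem at `x`, with relaxation `κ` and radius `β`. -/
def qpFeasible (x : Vec n) (κ β : ℝ) : Set (Vec n) :=
  {d | (∀ i, -κ ≤ P.h i x + ⟪∇ (P.h i) x, d⟫ ∧ P.h i x + ⟪∇ (P.h i) x, d⟫ ≤ κ) ∧
    (∀ j, P.c j x + ⟪∇ (P.c j) x, d⟫ ≤ κ) ∧ supNorm d ≤ β}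

/-- The stationarity measure `χ(x) = -min ∇f(x)ᵀt` over `∇h(x)ᵀt = 0`, `∇c(x)ᵀt ≤ 0`,
`‖t‖_∞ ≤ β_l / 2`. The feasible set is compact and contains `0`. -/
def chi (βl : ℝ) (x : Vec n) : ℝ :=
  -sInf ((fun t : Vec n => ⟪∇ P.f x, t⟫) ''
    {t | (∀ i, ⟪∇ (P.h i) x, t⟫ = 0) ∧ (∀ j, ⟪∇ (P.c j) x, t⟫ ≤ 0) ∧ supNorm t ≤ βl / 2})

/-- The extended Mangasarian-Fromovitz constraint qualification at `x`. -/
def EMFCQ (x : Vec n) : Prop :=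
  LinearIndependent ℝ (fun i => ∇ (P.h i) x) ∧
    ∃ z : Vec n, (∀ i, ⟪∇ (P.h i) x, z⟫ = 0) ∧ ∀ j, 0 ≤ P.c j x → ⟪∇ (P.c j) x, z⟫ < 0

end Problem

/-- The user-chosen parameters of the stochastic SQP algorithm. -/
structure Params where
  (σu κu βl βu γ θ αmax ρ0 pf pg0 ζ0 ζc : ℝ)
  (a : ℕ → ℝ)
  (j0 : ℤ)
  σu_pos : 0 < σu
  κu_pos : 0 < κu
  σu_βl : 2 * σu < βl
  βl_βu : βl < βu
  γ_gt : 1 < γ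
  θ_pos : 0 < θ
  θ_lt : θ < 1
  αmax_pos : 0 < αmax
  ρ0_pos : 0 < ρ0
  pf_pos : 0 < pf
  pf_le : pf ≤ 1
  pg0_pos : 0 < pg0
  ζ0_pos : 0 < ζ0
  ζc_pos : 0 < ζc
  a_mono : Monotone a
  a_zero : pg0 ≤ a 0
  a_pos : ∀ j, 0 < a j
  a_lt : ∀ j, a j < 1
  a_summable : Summable fun j => 1 - a j
  j0_neg : j0 < 0

/-- The random quantities handled by the algorithm, on a sample space `S`: iterates `x`, gradient
estimates `g`, search directions `d`, matrices `H`, radii `β`, function estimates `f0` (at `x k`)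
and `fs` (at `x k + α k • d k`), step sizes `α`, penalty parameters `ρ`, thresholds `ζ`,
probabilities `pg` and the counter `j`. -/
structure Run (n : ℕ) (S : Type*) where
  x : ℕ → S → Vec n
  g : ℕ → S → Vec n
  d : ℕ → S → Vec n
  H : ℕ → S → Matrix (Fin n) (Fin n) ℝ
  β : ℕ → S → ℝ
  f0 : ℕ → S → ℝ
  fs : ℕ → S → ℝ
  α : ℕ → S → ℝ
  ρ : ℕ → S → ℝ
  ζ : ℕ → S → ℝ
  pg : ℕ → S → ℝ
  j : ℕ → S → ℕ

namespace Run

variable {n m₁ m₂ : ℕ} {S : Type*} (R : Run n S) (P : Problem n m₁ m₂) (A : Params)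

/-- `σ_k = min {σ_u, κ_u φ(x_k)}`. -/
def sigma (k : ℕ) (ω : S) : ℝ := min A.σu (A.κu * P.phi (R.x k ω))

/-- `Δ_φ(x_k, σ_k)`. -/
def dPhi (k : ℕ) (ω : S) : ℝ := P.deltaPhi (R.x k ω) (R.sigma P A k ω)

/-- The objective `g_kᵀ d + ½ dᵀ H_k d` of the quadratic subproblem. -/
def qpObj (k : ℕ) (ω : S) (d : Vec n) : ℝ := ⟪R.g k ω, d⟫ + quadForm (R.H k ω) d / 2

/-- The feasible set of the quadratic subproblem at iteration `k`. -/
def qpSet (k : ℕ) (ω : S) : Set (Vec n) :=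
  P.qpFeasible (R.x k ω) (P.kappa (R.x k ω) (R.sigma P A k ω)) (R.β k ω)

/-- The trial point `x_k + α_k d_k`. -/
def trial (k : ℕ) (ω : S) : Vec n := R.x k ω + R.α k ω • R.d k ω

/-- The predicted reduction `-g_kᵀ d_k + ρ Δ_φ(x_k, σ_k)`. -/
def predRed (k : ℕ) (ω : S) (ρ : ℝ) : ℝ := -⟪R.g k ω, R.d k ω⟫ + ρ * R.dPhi P A k ω

/-- The test that leaves the penalty parameter unchanged. -/
def PenaltyOk (k : ℕ) (ω : S) : Prop :=
  quadForm (R.H k ω) (R.d k ω) / 2 ≤ R.predRed P A k ω (R.ρ k ω)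

/-- The stochastic line search test; the step is successful if it holds. -/
def Success (k : ℕ) (ω : S) : Prop :=
  A.θ * R.α k ω * R.predRed P A k ω (R.ρ (k + 1) ω) ≤
    (R.f0 k ω + R.ρ (k + 1) ω * P.phi (R.x k ω)) -
      (R.fs k ω + R.ρ (k + 1) ω * P.phi (R.trial k ω))

/-- `𝓕_{k-1}`: generated by `g_i`, `f_i^0`, `f_i^s` for `i < k` (trivial if `k = 0`). -/
def past (k : ℕ) : MeasurableSpace S :=
  ⨆ i : Fin k, MeasurableSpace.comap (R.g i) inferInstance ⊔
    MeasurableSpace.comap (R.f0 i) inferInstance ⊔ MeasurableSpace.comap (R.fs i) inferInstance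

/-- `𝓕_{k-1/2}`: generated by `𝓕_{k-1}` and `g_k`. -/
def halfPast (k : ℕ) : MeasurableSpace S :=
  R.past k ⊔ MeasurableSpace.comap (R.g k) inferInstance

/-- The random quantities `R` are generated by the stochastic SQP algorithm with parameters `A`
from the starting point `x₀`. -/
structure IsGenerated [MeasurableSpace S] (x₀ : Vec n) : Prop where
  g_meas : ∀ k, Measurable (R.g k)
  f0_meas : ∀ k, Measurable (R.f0 k)
  fs_meas : ∀ k, Measurable (R.fs k)
  H_meas : ∀ k p q, Measurable[R.past k] fun ω => R.H k ω p q
  β_meas : ∀ k, Measurable[R.past k] (R.β k)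
  d_meas : ∀ k, Measurable[R.halfPast k] (R.d k)
  x_init : ∀ ω, R.x 0 ω = x₀
  α_init : ∀ ω, R.α 0 ω = A.γ ^ A.j0 * A.αmax
  ρ_init : ∀ ω, R.ρ 0 ω = A.ρ0
  ζ_init : ∀ ω, R.ζ 0 ω = A.ζ0
  pg_init : ∀ ω, R.pg 0 ω = A.pg0
  j_init : ∀ ω, R.j 0 ω = 1
  β_mem : ∀ k ω, R.β k ω ∈ Set.Icc A.βl A.βu
  -- the matrix is recomputed only after a nonzero step
  H_keep : ∀ k ω, R.x (k + 1) ω = R.x k ω → R.H (k + 1) ω = R.H k ω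
  -- `d_k` solves the quadratic subproblem
  d_mem : ∀ k ω, R.d k ω ∈ R.qpSet P A k ω
  d_min : ∀ k ω, IsMinOn (R.qpObj k ω) (R.qpSet P A k ω) (R.d k ω)
  -- monitoring the size of `g_k`
  large : ∀ k ω, R.ζ k ω < ‖R.g k ω‖ →
    R.ζ (k + 1) ω = max (R.ζ k ω + A.ζc) ‖R.g k ω‖ ∧
      R.pg (k + 1) ω = A.a (R.j k ω) ∧ R.j (k + 1) ω = R.j k ω + 1
  small : ∀ k ω, ‖R.g k ω‖ ≤ R.ζ k ω →
    R.ζ (k + 1) ω = R.ζ k ω ∧ R.pg (k + 1) ω = R.pg k ω ∧ R.j (k + 1) ω = R.j k ω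
  -- penalty update; if the test fails, then `Δ_φ(x_k, σ_k) > 0` automatically
  penalty_keep : ∀ k ω, R.PenaltyOk P A k ω → R.ρ (k + 1) ω = R.ρ k ω
  penalty_raise : ∀ k ω, ¬ R.PenaltyOk P A k ω →
    R.ρ (k + 1) ω = max (R.qpObj k ω (R.d k ω) / R.dPhi P A k ω) (2 * R.ρ k ω)
  -- line search
  success : ∀ k ω, R.Success P A k ω →
    R.x (k + 1) ω = R.trial k ω ∧ R.α (k + 1) ω = min (A.γ * R.α k ω) A.αmax
  failure : ∀ k ω, ¬ R.Success P A k ω →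
    R.x (k + 1) ω = R.x k ω ∧ R.α (k + 1) ω = A.γ⁻¹ * R.α k ω

/-- Boundedness and smoothness on a bounded closed set `Om` that contains the iterates and the
trial points, and uniform bounds on the matrices `H_k`. -/
structure Regular [MeasurableSpace S] (μ : Measure S) (Om : Set (Vec n))
    (Lf : ℝ) (Lh : Fin m₁ → ℝ) (Lc : Fin m₂ → ℝ) (ξ MH : ℝ) : Prop where
  bounded : Bornology.IsBounded Om
  closed : IsClosed Om
  mem : ∀ᵐ ω ∂μ, ∀ k, ∀ α ∈ Set.Icc 0 (R.α k ω), R.x k ω + α • R.d k ω ∈ Om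
  f_smooth : ContDiff ℝ 1 P.f
  h_smooth : ∀ i, ContDiff ℝ 1 (P.h i)
  c_smooth : ∀ j, ContDiff ℝ 1 (P.c j)
  f_below : BddBelow (P.f '' Om)
  f_lip : ∀ x ∈ Om, ∀ y ∈ Om, ‖∇ P.f x - ∇ P.f y‖ ≤ Lf * ‖x - y‖
  h_bdd : ∀ i, Bornology.IsBounded (P.h i '' Om) ∧ Bornology.IsBounded (∇ (P.h i) '' Om)
  h_lip : ∀ i, ∀ x ∈ Om, ∀ y ∈ Om, ‖∇ (P.h i) x - ∇ (P.h i) y‖ ≤ Lh i * ‖x - y‖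
  c_bdd : ∀ j, Bornology.IsBounded (P.c j '' Om) ∧ Bornology.IsBounded (∇ (P.c j) '' Om)
  c_lip : ∀ j, ∀ x ∈ Om, ∀ y ∈ Om, ‖∇ (P.c j) x - ∇ (P.c j) y‖ ≤ Lc j * ‖x - y‖
  ξ_pos : 0 < ξ
  MH_pos : 0 < MH
  H_bdd : ∀ᵐ ω ∂μ, ∀ k, ∀ d : Vec n,
    2 * ξ * ‖d‖ ^ 2 ≤ quadForm (R.H k ω) d ∧ quadForm (R.H k ω) d ≤ MH * ‖d‖ ^ 2

/-- The event `I_k` that the gradient estimate is `κ_g`-sufficiently accurate. -/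
def gradAcc (κg : ℝ) (k : ℕ) : Set S :=
  {ω | ‖R.g k ω - ∇ P.f (R.x k ω)‖ ≤ κg * R.α k ω * ‖R.d k ω‖}

/-- The event `J_k` that the function estimates are `ε_f`-sufficiently accurate. -/
def funAcc (εf : ℝ) (k : ℕ) : Set S :=
  {ω | |R.f0 k ω - P.f (R.x k ω)| ≤ εf * R.α k ω ^ 2 * ‖R.d k ω‖ ^ 2 ∧
    |R.fs k ω - P.f (R.trial k ω)| ≤ εf * R.α k ω ^ 2 * ‖R.d k ω‖ ^ 2}

/-- Probabilistic accuracy: `Pr(I_k | 𝓕_{k-1}) ≥ p_k^g` and `Pr(J_k | 𝓕_{k-1/2}) ≥ p_f`. -/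
structure ProbAccurate [MeasurableSpace S] (μ : Measure S) (κg εf : ℝ) : Prop where
  grad : ∀ k, ∀ᵐ ω ∂μ,
    R.pg k ω ≤ (μ[(R.gradAcc P κg k).indicator (fun _ => (1 : ℝ)) | R.past k]) ω
  func : ∀ k, ∀ᵐ ω ∂μ,
    A.pf ≤ (μ[(R.funAcc P εf k).indicator (fun _ => (1 : ℝ)) | R.halfPast k]) ω

/-- The extended MFCQ holds almost surely at every accumulation point of the iterates. -/
def EMFCQAtAccPts [MeasurableSpace S] (μ : Measure S) : Prop :=
  ∀ᵐ ω ∂μ, ∀ y : Vec n, MapClusterPt y atTop (fun k => R.x k ω) → P.EMFCQ y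

/-- The optimality measure `φ(x_k)² + χ(x_k)²`. -/
def optMeasure (k : ℕ) (ω : S) : ℝ := P.phi (R.x k ω) ^ 2 + P.chi A.βl (R.x k ω) ^ 2

/-- The `κ_f`-variance condition on the function estimates. -/
structure VarianceCond [MeasurableSpace S] (μ : Measure S) (κf : ℝ) : Prop where
  fs_int : ∀ k, Integrable (fun ω => |R.fs k ω - P.f (R.trial k ω)| ^ 2) μ
  f0_int : ∀ k, Integrable (fun ω => |R.f0 k ω - P.f (R.x k ω)| ^ 2) μ
  fs_var : ∀ k, ∀ᵐ ω ∂μ,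
    (μ[fun ω' => |R.fs k ω' - P.f (R.trial k ω')| ^ 2 | R.halfPast k]) ω ≤
      κf ^ 2 * R.α k ω ^ 2 * R.optMeasure P A k ω ^ 2
  f0_var : ∀ k, ∀ᵐ ω ∂μ,
    (μ[fun ω' => |R.f0 k ω' - P.f (R.x k ω')| ^ 2 | R.halfPast k]) ω ≤
      κf ^ 2 * R.α k ω ^ 2 * R.optMeasure P A k ω ^ 2

end Run

end

end StochSQP

/-! ### Norms, the distance to the cone, and first-order estimates. -/

namespace StochSQP

variable {n m₁ m₂ : ℕ}

/-! Fix a sample path and suppose that `optMeasure` stays above some ε > 0 from some index on.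
Compactness and the extended MFCQ at accumulation points make Δ_φ at least a fixed multiple of φ
along the tail (`exists_le_deltaPhi_of_mapClusterPt`). Bounded gradient estimates therefore bound ρ
wherever it is raised (`rho_le_of_not_penaltyOk`), and since every raise at least doubles ρ, it is
eventually a constant r; if ρ itself is bounded, the same follows directly. From then on there is a
single merit function f + rφ, bounded on the compact set.

Call an iteration good if I_k and J_k both occur; given the past, this has probability at least p_f
p_0^g > 1/2. Good iterations with small α succeed (`success_of_good`). A successful good iteration
lowers the merit function by a multiple of α‖d‖² (`merit_decrease`), and ‖d‖ ≥ δ there, because a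
short d would certify near-stationarity (`exists_le_norm_d`).

Probability enters twice. While α is small, log_γ α rises at least as fast as a walk that is almost
surely unbounded above, so α returns to a fixed threshold infinitely often
(`ae_not_bddAbove_sum_indicator`, `frequently_le_alpha`). By Lévy's form of the Borel–Cantelli
lemma, infinitely many of these returns start N consecutive good iterations, for every N
(`ae_frequently_run`). A long enough run would push the merit function below its lower bound
(`exists_run_length`), a contradiction. The effect of bad iterations on the merit function never has
to be controlled beyond its boundedness. -/

lemma supNorm_nonneg (p : Vec n) : 0 ≤ supNorm p := norm_nonneg _

lemma supNorm_zero : supNorm (0 : Vec n) = 0 := by simp [supNorm]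

lemma supNorm_le_norm (p : Vec n) : supNorm p ≤ ‖p‖ :=
  (pi_norm_le_iff_of_nonneg (norm_nonneg _)).2 fun i => PiLp.norm_apply_le p i

lemma norm_le_supNorm (p : Vec n) : ‖p‖ ≤ √n * supNorm p := by
  rw [EuclideanSpace.norm_eq]
  refine Real.sqrt_le_iff.2 ⟨mul_nonneg (Real.sqrt_nonneg _) (supNorm_nonneg p), ?_⟩
  rw [mul_pow, Real.sq_sqrt (Nat.cast_nonneg n)]
  calc ∑ i, ‖p i‖ ^ 2 ≤ ∑ _i : Fin n, supNorm p ^ 2 :=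
        Finset.sum_le_sum fun i _ =>
          pow_le_pow_left₀ (norm_nonneg _) (norm_le_pi_norm (WithLp.ofLp p) i) 2
    _ = n * supNorm p ^ 2 := by simp

lemma supNorm_add_le (p q : Vec n) : supNorm (p + q) ≤ supNorm p + supNorm q := by
  simpa [supNorm] using norm_add_le (WithLp.ofLp p) (WithLp.ofLp q)

lemma supNorm_smul (s : ℝ) (p : Vec n) : supNorm (s • p) = |s| * supNorm p := by
  simp [supNorm, norm_smul]

lemma continuous_supNorm : Continuous (supNorm : Vec n → ℝ) :=
  (PiLp.continuous_ofLp 2 _).norm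

lemma isCompact_supNorm_le (σ : ℝ) : IsCompact {p : Vec n | supNorm p ≤ σ} := by
  refine Metric.isCompact_of_isClosed_isBounded
    (isClosed_le continuous_supNorm continuous_const) ?_
  refine (Metric.isBounded_closedBall (x := (0 : Vec n)) (r := √n * σ)).subset fun p hp => ?_
  rw [mem_closedBall_zero_iff]
  exact (norm_le_supNorm p).trans (mul_le_mul_of_nonneg_left hp (Real.sqrt_nonneg _))

lemma zero_mem_coneK : (0 : (Fin m₁ → ℝ) × (Fin m₂ → ℝ)) ∈ coneK m₁ m₂ := by
  simp [coneK]

lemma isClosed_coneK : IsClosed (coneK m₁ m₂) := by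
  rw [show coneK m₁ m₂ = {y | y.1 = 0} ∩ ⋂ j, {y | y.2 j ≤ 0} by ext; simp [coneK]]
  exact (isClosed_eq continuous_fst continuous_const).inter
    (isClosed_iInter fun j => isClosed_le (by fun_prop) continuous_const)

/-- The `ℓ∞` distance to `K` in coordinates. -/
lemma infDist_coneK_le_iff {y : (Fin m₁ → ℝ) × (Fin m₂ → ℝ)} {r : ℝ} (hr : 0 ≤ r) :
    Metric.infDist y (coneK m₁ m₂) ≤ r ↔ (∀ i, |y.1 i| ≤ r) ∧ ∀ j, y.2 j ≤ r := by
  constructor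
  · intro h
    obtain ⟨w, hw, hwd⟩ := isClosed_coneK.exists_infDist_eq_dist ⟨_, zero_mem_coneK⟩ y
    rw [hwd, Prod.dist_eq, max_le_iff, dist_pi_le_iff hr, dist_pi_le_iff hr] at h
    refine ⟨fun i => ?_, fun j => ?_⟩
    · simpa [hw.1, Real.dist_eq] using h.1 i
    · have h1 := h.2 j
      rw [Real.dist_eq] at h1
      linarith [le_of_abs_le h1, hw.2 j]
  · rintro ⟨h1, h2⟩
    -- The coordinatewise projection onto the cone is a nearest point for the sup metric.
    have hw : ((0 : Fin m₁ → ℝ), fun j => min (y.2 j) 0) ∈ coneK m₁ m₂ :=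
      ⟨rfl, fun j => min_le_right _ _⟩
    refine (Metric.infDist_le_dist_of_mem hw).trans ?_
    rw [Prod.dist_eq, max_le_iff, dist_pi_le_iff hr, dist_pi_le_iff hr]
    refine ⟨fun i => by simpa [Real.dist_eq] using h1 i, fun j => ?_⟩
    rw [Real.dist_eq, abs_le]
    dsimp only
    rcases le_total (y.2 j) 0 with h | h
    · rw [min_eq_left h]; constructor <;> linarith
    · rw [min_eq_right h]; constructor <;> linarith [h2 j]

lemma continuous_gradient {F : Vec n → ℝ} (hF : ContDiff ℝ 1 F) : Continuous (∇ F) :=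
  (InnerProductSpace.toDual ℝ (Vec n)).symm.continuous.comp (hF.continuous_fderiv one_ne_zero)

/-- First-order Taylor estimate along a segment on which the gradient is Lipschitz. -/
lemma abs_taylor_le {F : Vec n → ℝ} (hF : ContDiff ℝ 1 F) {Om : Set (Vec n)} {L : ℝ}
    (hL : ∀ x ∈ Om, ∀ y ∈ Om, ‖∇ F x - ∇ F y‖ ≤ L * ‖x - y‖) {x d : Vec n} {α : ℝ} (hα : 0 ≤ α)
    (hseg : ∀ t ∈ Set.Icc 0 α, x + t • d ∈ Om) :
    |F (x + α • d) - F x - α * ⟪∇ F x, d⟫| ≤ |L| * α ^ 2 * ‖d‖ ^ 2 := by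
  have hx : x ∈ Om := by simpa using hseg 0 ⟨le_rfl, hα⟩
  have hsub : ∀ z ∈ segment ℝ x (x + α • d), z ∈ Om ∧ ‖z - x‖ ≤ α * ‖d‖ := by
    intro z hz
    rw [segment_eq_image'] at hz
    obtain ⟨t, ht, rfl⟩ := hz
    have h1 : x + t • (x + α • d - x) = x + (t * α) • d := by
      rw [add_sub_cancel_left, smul_smul]
    simp only [h1]
    have h2 : t * α ≤ α := by nlinarith [ht.1, ht.2]
    have h3 : 0 ≤ t * α := mul_nonneg ht.1 hα
    refine ⟨hseg _ ⟨h3, h2⟩, ?_⟩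
    rw [add_sub_cancel_left, norm_smul, Real.norm_of_nonneg h3]
    exact mul_le_mul_of_nonneg_right h2 (norm_nonneg _)
  have key := Convex.norm_image_sub_le_of_norm_fderiv_le' (f := F) (𝕜 := ℝ)
    (s := segment ℝ x (x + α • d)) (φ := fderiv ℝ F x) (C := |L| * (α * ‖d‖))
    (fun z _ => hF.differentiable one_ne_zero z) (fun z hz => ?_) (convex_segment _ _)
    (left_mem_segment ℝ x _) (right_mem_segment ℝ x _)
  · rw [add_sub_cancel_left, norm_smul, Real.norm_of_nonneg hα, map_smul, Real.norm_eq_abs] at key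
    rw [inner_gradient_left]
    refine key.trans_eq (by ring)
  · rw [← toDual_gradient, ← toDual_gradient, ← map_sub, LinearIsometryEquiv.norm_map]
    obtain ⟨h1, h2⟩ := hsub z hz
    exact (hL z h1 x hx).trans ((mul_le_mul_of_nonneg_right (le_abs_self L) (norm_nonneg _)).trans
      (mul_le_mul_of_nonneg_left h2 (abs_nonneg L)))

namespace Problem

variable (P : Problem n m₁ m₂)

lemma phi_nonneg (x : Vec n) : 0 ≤ P.phi x := Metric.infDist_nonneg

lemma linPhi_nonneg (x p : Vec n) : 0 ≤ P.linPhi x p := Metric.infDist_nonneg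

lemma phi_le_iff {x : Vec n} {r : ℝ} (hr : 0 ≤ r) :
    P.phi x ≤ r ↔ (∀ i, |P.h i x| ≤ r) ∧ ∀ j, P.c j x ≤ r :=
  infDist_coneK_le_iff hr

lemma linPhi_le_iff {x p : Vec n} {r : ℝ} (hr : 0 ≤ r) :
    P.linPhi x p ≤ r ↔ (∀ i, |P.h i x + ⟪∇ (P.h i) x, p⟫| ≤ r) ∧
      ∀ j, P.c j x + ⟪∇ (P.c j) x, p⟫ ≤ r :=
  infDist_coneK_le_iff hr

lemma abs_h_le_phi (x : Vec n) (i : Fin m₁) : |P.h i x| ≤ P.phi x :=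
  ((P.phi_le_iff (P.phi_nonneg x)).1 le_rfl).1 i

lemma c_le_phi (x : Vec n) (j : Fin m₂) : P.c j x ≤ P.phi x :=
  ((P.phi_le_iff (P.phi_nonneg x)).1 le_rfl).2 j

lemma bddBelow_linPhi (x : Vec n) (s : Set (Vec n)) : BddBelow (P.linPhi x '' s) :=
  ⟨0, by rintro _ ⟨p, -, rfl⟩; exact P.linPhi_nonneg x p⟩

lemma kappa_nonneg (x : Vec n) (σ : ℝ) : 0 ≤ P.kappa x σ :=
  Real.sInf_nonneg (by rintro _ ⟨p, -, rfl⟩; exact P.linPhi_nonneg x p)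

lemma kappa_le_linPhi {x p : Vec n} {σ : ℝ} (hp : supNorm p ≤ σ) : P.kappa x σ ≤ P.linPhi x p :=
  csInf_le (P.bddBelow_linPhi x _) ⟨p, hp, rfl⟩

lemma continuous_linPhi_right (x : Vec n) : Continuous (P.linPhi x) :=
  (Metric.continuous_infDist_pt _).comp (by fun_prop)

/-- The infimum defining `κ(x, σ)` is attained. -/
lemma exists_linPhi_eq_kappa (x : Vec n) {σ : ℝ} (hσ : 0 ≤ σ) :
    ∃ p, supNorm p ≤ σ ∧ P.linPhi x p = P.kappa x σ := by
  obtain ⟨p, hp, h⟩ := (isCompact_supNorm_le (n := n) σ).exists_sInf_image_eq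
    ⟨0, by simpa [supNorm_zero] using hσ⟩ (P.continuous_linPhi_right x).continuousOn
  exact ⟨p, hp, h.symm⟩

lemma mem_qpFeasible_iff {x d : Vec n} {κ β : ℝ} (hκ : 0 ≤ κ) :
    d ∈ P.qpFeasible x κ β ↔ P.linPhi x d ≤ κ ∧ supNorm d ≤ β := by
  simp only [qpFeasible, Set.mem_ofPred_eq, P.linPhi_le_iff hκ, abs_le, and_assoc]

lemma continuous_phi (hh : ∀ i, ContDiff ℝ 1 (P.h i)) (hc : ∀ j, ContDiff ℝ 1 (P.c j)) :
    Continuous P.phi :=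
  (Metric.continuous_infDist_pt _).comp
    ((continuous_pi fun i => (hh i).continuous).prodMk (continuous_pi fun j => (hc j).continuous))

/-- The parametrization `p = σ q` with `‖q‖_∞ ≤ 1` makes the domain of the infimum constant. -/
lemma kappa_eq_sInf_unit (x : Vec n) {σ : ℝ} (hσ : 0 ≤ σ) :
    P.kappa x σ = sInf ((fun q => P.linPhi x (σ • q)) '' {q | supNorm q ≤ 1}) := by
  have : {p : Vec n | supNorm p ≤ σ} = (fun q => σ • q) '' {q | supNorm q ≤ 1} := by
    ext p
    constructor
    · intro hp
      -- Radius zero does occur: `sigma` vanishes exactly at feasible points.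
      rcases hσ.eq_or_lt with rfl | h
      · refine ⟨0, by simp [supNorm_zero], ?_⟩
        have : ‖p‖ ≤ √n * 0 :=
          (norm_le_supNorm p).trans (mul_le_mul_of_nonneg_left hp (Real.sqrt_nonneg _))
        rw [mul_zero, norm_le_zero_iff] at this
        simp [this]
      · refine ⟨σ⁻¹ • p, ?_, smul_inv_smul₀ h.ne' p⟩
        rw [Set.mem_ofPred_eq, supNorm_smul, abs_of_pos (inv_pos.2 h), inv_mul_le_iff₀ h, mul_one]
        exact hp
    · rintro ⟨q, hq, rfl⟩
      rw [Set.mem_ofPred_eq, supNorm_smul, abs_of_nonneg hσ]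
      exact mul_le_of_le_one_right hσ hq
  rw [kappa, this, Set.image_image]

/-- Over the fixed compact unit ball the infimum of a jointly continuous function is continuous in
the parameter. This is what makes the penalty update and the line search test measurable. -/
lemma continuous_deltaPhi (hh : ∀ i, ContDiff ℝ 1 (P.h i)) (hc : ∀ j, ContDiff ℝ 1 (P.c j))
    {σ : Vec n → ℝ} (hσ : Continuous σ) (hσ0 : ∀ x, 0 ≤ σ x) :
    Continuous fun x => P.deltaPhi x (σ x) := by
  refine (P.continuous_phi hh hc).sub ?_
  simp only [fun x => P.kappa_eq_sInf_unit x (hσ0 x)]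
  refine (isCompact_supNorm_le (n := n) 1).continuous_sInf
    (f := fun x q => P.linPhi x (σ x • q)) ?_
  have h1 := fun i => continuous_gradient (hh i)
  have h2 := fun j => continuous_gradient (hc j)
  have h3 := fun i => (hh i).continuous
  have h4 := fun j => (hc j).continuous
  refine (Metric.continuous_infDist_pt _).comp (Continuous.prodMk
    (continuous_pi fun i => ?_) (continuous_pi fun j => ?_))
  · exact ((h3 i).comp continuous_fst).add (((h1 i).comp continuous_fst).inner
      ((hσ.comp continuous_fst).smul continuous_snd))
  · exact ((h4 j).comp continuous_fst).add (((h2 j).comp continuous_fst).inner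
      ((hσ.comp continuous_fst).smul continuous_snd))

end Problem

end StochSQP

/-! ### Consequences of the extended MFCQ. -/

namespace StochSQP

open scoped Topology

variable {n m₁ m₂ : ℕ}

/-- A linearly independent family in `ℝⁿ` has a biorthogonal family. -/
lemma exists_biorthogonal {v : Fin m₁ → Vec n} (hv : LinearIndependent ℝ v) :
    ∃ b : Fin m₁ → Vec n, ∀ i j, ⟪v i, b j⟫ = if i = j then 1 else 0 := by
  have h : ∀ j, ∃ b : Vec n, ∀ i, ⟪v i, b⟫ = if i = j then 1 else 0 := by
    intro j
    -- The j-th coordinate functional on the span, extended to the whole space and represented by a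
    -- vector through Riesz.
    obtain ⟨l, hl⟩ := LinearMap.exists_extend ((Finsupp.lapply j) ∘ₗ hv.repr)
    refine ⟨(InnerProductSpace.toDual ℝ (Vec n)).symm (LinearMap.toContinuousLinearMap l),
      fun i => ?_⟩
    rw [real_inner_comm, InnerProductSpace.toDual_symm_apply]
    have h1 := LinearMap.congr_fun hl ⟨v i, Submodule.subset_span ⟨i, rfl⟩⟩
    have h2 : hv.repr ⟨v i, Submodule.subset_span ⟨i, rfl⟩⟩ = Finsupp.single i 1 :=
      hv.repr_eq_single i _ rfl
    simp only [LinearMap.comp_apply, h2] at h1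
    simpa [Finsupp.single_apply] using h1
  choose b hb using h
  exact ⟨b, fun i j => hb j i⟩

/-- Finitely many bounds of this form hold simultaneously for some s > 0, whatever the signs of the
factors; small constants are chosen this way throughout. -/
lemma eventually_mul_le (a : ℝ) {A : ℝ} (hA : 0 < A) : ∀ᶠ s in 𝓝[>] (0 : ℝ), s * a ≤ A := by
  have h : Tendsto (fun s : ℝ => s * a) (𝓝 0) (𝓝 (0 * a)) := tendsto_id.mul_const a
  rw [zero_mul] at h
  exact nhdsWithin_le_nhds ((h.eventually_lt_const hA).mono fun _ h => h.le)

namespace Problem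

variable {P : Problem n m₁ m₂}

/-- Near a point satisfying the extended MFCQ, the linearized infeasibility can be reduced by a
fixed fraction of the infeasibility. -/
lemma EMFCQ.exists_le_deltaPhi (hh : ∀ i, ContDiff ℝ 1 (P.h i)) (hc : ∀ j, ContDiff ℝ 1 (P.c j))
    {y : Vec n} (hy : P.EMFCQ y) {σu κu : ℝ} (hσu : 0 < σu) (hκu : 0 < κu) :
    ∃ c > 0, ∀ᶠ x in 𝓝 y, c * P.phi x ≤ P.deltaPhi x (min σu (κu * P.phi x)) := by
  obtain ⟨hli, z, hz, hzc⟩ := hy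
  obtain ⟨b, hb⟩ := exists_biorthogonal hli
  -- One margin η for both kinds of inequality: descent along z when `P.c j y` is nonnegative, slack
  -- when it is negative.
  obtain ⟨η, hη, hηj⟩ : ∃ η > 0, ∀ j, (0 ≤ P.c j y → ⟪∇ (P.c j) y, z⟫ ≤ -η) ∧
      (P.c j y < 0 → P.c j y < -η) := by
    have : ∀ᶠ η in 𝓝[>] (0 : ℝ), ∀ j, (0 ≤ P.c j y → ⟪∇ (P.c j) y, z⟫ ≤ -η) ∧
        (P.c j y < 0 → P.c j y < -η) := by
      refine eventually_all.2 fun j => ?_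
      rcases le_or_gt 0 (P.c j y) with h | h
      · filter_upwards [eventually_mul_le 1 (neg_pos.2 (hzc j h))] with η hη
        exact ⟨fun _ => by linarith, fun h' => absurd h' (not_lt.2 h)⟩
      · filter_upwards [eventually_mul_le 2 (neg_pos.2 h)] with η hη
        exact ⟨fun h' => absurd h (not_lt.2 h'), fun _ => by linarith⟩
    obtain ⟨η, h1, h2⟩ := (this.and self_mem_nhdsWithin).exists
    exact ⟨η, h2, h1⟩
  set Cb := ∑ i, ‖b i‖ with hCb
  set Gc := ∑ j, ‖∇ (P.c j) y‖ with hGc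
  have hCb0 : 0 ≤ Cb := Finset.sum_nonneg fun _ _ => norm_nonneg _
  have hGc0 : 0 ≤ Gc := Finset.sum_nonneg fun _ _ => norm_nonneg _
  have hGcj : ∀ j, ‖∇ (P.c j) y‖ ≤ Gc := fun j =>
    Finset.single_le_sum (f := fun j => ‖∇ (P.c j) y‖) (fun _ _ => norm_nonneg _)
      (Finset.mem_univ j)
  -- Large enough for the descent along z to absorb the effect of the equality correction q on the
  -- inequalities and still leave -φ.
  set t := (Gc * Cb + 1) / η with ht
  have ht0 : 0 ≤ t := by positivity
  have htη : t * η = Gc * Cb + 1 := div_mul_cancel₀ _ hη.ne'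
  set C := Cb + t * ‖z‖ + 1 with hC
  have hC0 : 0 < C := by positivity
  set Φ := P.phi y + 1 with hΦ
  have hΦ0 : 0 < Φ := by linarith [P.phi_nonneg y]
  -- The bounds make s a convex weight, keep `s • u` within both parts of the radius, and keep
  -- inactive constraints nonpositive.
  obtain ⟨s, ⟨hs1, hs2, hs3, hs4⟩, hs0⟩ : ∃ s : ℝ, (s * 1 ≤ 1 ∧ s * C ≤ κu ∧ s * (C * Φ) ≤ σu ∧
      s * ((Gc * C + 1) * Φ) ≤ η) ∧ 0 < s :=
    (((eventually_mul_le 1 one_pos).and ((eventually_mul_le C hκu).and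
      ((eventually_mul_le (C * Φ) hσu).and (eventually_mul_le _ hη)))).and
        self_mem_nhdsWithin).exists
  have near : ∀ {F : Vec n → ℝ}, ContDiff ℝ 1 F →
      ∀ᶠ x in 𝓝 y, ‖∇ F x - ∇ F y‖ < 1 / (2 * C) := fun hF => by
    have := (continuous_gradient hF).continuousAt (x := y)
    filter_upwards [Metric.tendsto_nhds.1 this (1 / (2 * C)) (by positivity)] with x hx
    rwa [← dist_eq_norm]
  refine ⟨s / 2, by positivity, ?_⟩
  have e1 := eventually_all.2 fun i => near (hh i)
  have e2 := eventually_all.2 fun j => near (hc j)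
  have e3 : ∀ᶠ x in 𝓝 y, P.phi x < Φ :=
    (P.continuous_phi hh hc).continuousAt.eventually_lt_const (by linarith)
  have e4 : ∀ᶠ x in 𝓝 y, ∀ j, P.c j y < 0 → P.c j x < -η := by
    refine eventually_all.2 fun j => ?_
    by_cases h : P.c j y < 0
    · filter_upwards [(hc j).continuous.continuousAt.eventually_lt_const ((hηj j).2 h)]
        with x hx _ using hx
    · exact Eventually.of_forall fun _ h' => absurd h' h
  filter_upwards [e1, e2, e3, e4] with x hx1 hx2 hx3 hx4
  set φ := P.phi x with hφ
  have hφ0 : 0 ≤ φ := P.phi_nonneg x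
  -- With the gradients at y, q cancels the linearized equalities exactly. Replacing them by
  -- gradients at x costs at most φ/2 (`hpert`), so a step s along u still removes the fraction s/2
  -- of φ.
  set q : Vec n := ∑ i, (-P.h i x) • b i with hq
  set u : Vec n := q + (φ * t) • z with hu
  have hqn : ‖q‖ ≤ φ * Cb := by
    rw [hCb, Finset.mul_sum]
    refine norm_sum_le_of_le _ fun i _ => ?_
    rw [norm_smul, norm_neg, Real.norm_eq_abs]
    exact mul_le_mul_of_nonneg_right (P.abs_h_le_phi x i) (norm_nonneg _)
  have hun : ‖u‖ ≤ C * φ := by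
    refine (norm_add_le _ _).trans ?_
    rw [norm_smul, Real.norm_of_nonneg (mul_nonneg hφ0 ht0), hC]
    nlinarith
  have hpert : ∀ v w : Vec n, ‖v - w‖ < 1 / (2 * C) → |⟪v, u⟫ - ⟪w, u⟫| ≤ φ / 2 := by
    intro v w hvw
    rw [← inner_sub_left]
    calc |⟪v - w, u⟫| ≤ ‖v - w‖ * ‖u‖ := abs_real_inner_le_norm _ _
      _ ≤ 1 / (2 * C) * (C * φ) := mul_le_mul hvw.le hun (norm_nonneg _) (by positivity)
      _ = φ / 2 := by field_simp
  have hhu : ∀ i, ⟪∇ (P.h i) y, u⟫ = -P.h i x := by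
    intro i
    rw [hu, inner_add_right, inner_smul_right, hz i, mul_zero, add_zero, hq, inner_sum]
    simp [inner_smul_right, hb]
  have hcu : ∀ j, 0 ≤ P.c j y → ⟪∇ (P.c j) y, u⟫ ≤ -φ := by
    intro j hj
    have h1 : ⟪∇ (P.c j) y, q⟫ ≤ Gc * (φ * Cb) :=
      (real_inner_le_norm _ _).trans (mul_le_mul (hGcj j) hqn (norm_nonneg _) hGc0)
    have h2 : φ * t * ⟪∇ (P.c j) y, z⟫ ≤ φ * t * -η :=
      mul_le_mul_of_nonneg_left ((hηj j).1 hj) (mul_nonneg hφ0 ht0)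
    have h3 : φ * t * -η = -(φ * (Gc * Cb + 1)) := by rw [← htη]; ring
    rw [hu, inner_add_right, inner_smul_right]
    linarith
  have hsup : supNorm (s • u) ≤ min σu (κu * φ) := by
    have h1 : supNorm (s • u) ≤ s * (C * φ) := by
      rw [supNorm_smul, abs_of_pos hs0]
      exact mul_le_mul_of_nonneg_left ((supNorm_le_norm u).trans hun) hs0.le
    refine le_min (h1.trans (le_trans ?_ hs3)) (h1.trans ?_)
    · gcongr
    · rw [← mul_assoc]; gcongr
  have hlin : P.linPhi x (s • u) ≤ (1 - s / 2) * φ := by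
    have hr : 0 ≤ (1 - s / 2) * φ := mul_nonneg (by linarith) hφ0
    refine (P.linPhi_le_iff hr).2 ⟨fun i => ?_, fun j => ?_⟩
    · have h1 := abs_le.1 (hpert _ _ (hx1 i))
      rw [hhu i] at h1
      have h2 := abs_le.1 (P.abs_h_le_phi x i)
      rw [inner_smul_right, abs_le]
      constructor <;> nlinarith
    · rw [inner_smul_right]
      have h1 := abs_le.1 (hpert _ _ (hx2 j))
      rcases le_or_gt 0 (P.c j y) with h | h
      · have h2 := hcu j h
        have h3 := P.c_le_phi x j
        nlinarith
      · have h2 := hx4 j h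
        have h3 : ⟪∇ (P.c j) y, u⟫ ≤ Gc * (C * φ) :=
          (real_inner_le_norm _ _).trans (mul_le_mul (hGcj j) hun (norm_nonneg _) hGc0)
        have h4 : ⟪∇ (P.c j) x, u⟫ ≤ (Gc * C + 1) * Φ := by
          have : (Gc * C + 1) * φ ≤ (Gc * C + 1) * Φ := by gcongr
          nlinarith
        have h5 := mul_le_mul_of_nonneg_left h4 hs0.le
        linarith
  have := P.kappa_le_linPhi (x := x) hsup
  rw [deltaPhi]
  linarith

/-- A uniform version of `EMFCQ.exists_le_deltaPhi` along a sequence in a compact set. -/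
lemma exists_le_deltaPhi_of_mapClusterPt (hh : ∀ i, ContDiff ℝ 1 (P.h i))
    (hc : ∀ j, ContDiff ℝ 1 (P.c j)) {σu κu : ℝ} (hσu : 0 < σu) (hκu : 0 < κu)
    {Om : Set (Vec n)} (hOm : IsCompact Om) {x : ℕ → Vec n} (hx : ∀ k, x k ∈ Om)
    (hcl : ∀ y, MapClusterPt y atTop x → P.EMFCQ y) :
    ∃ c > 0, ∀ᶠ k in atTop,
      c * P.phi (x k) ≤ P.deltaPhi (x k) (min σu (κu * P.phi (x k))) := by
  have key : ∃ c > 0, ∀ᶠ k in atTop, x k ∈ Om →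
      c * P.phi (x k) ≤ P.deltaPhi (x k) (min σu (κu * P.phi (x k))) := by
    refine hOm.induction_on (p := fun s => ∃ c > 0, ∀ᶠ k in atTop, x k ∈ s →
      c * P.phi (x k) ≤ P.deltaPhi (x k) (min σu (κu * P.phi (x k)))) ?_ ?_ ?_ ?_
    · exact ⟨1, one_pos, Eventually.of_forall fun k h => absurd h (Set.notMem_empty _)⟩
    · rintro s t hst ⟨c, hc0, h⟩
      exact ⟨c, hc0, h.mono fun k hk hks => hk (hst hks)⟩
    · rintro s t ⟨c, hc0, h⟩ ⟨c', hc0', h'⟩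
      refine ⟨min c c', lt_min hc0 hc0', ?_⟩
      filter_upwards [h, h'] with k hk hk' hkst
      have h0 := P.phi_nonneg (x k)
      rcases hkst with hks | hkt
      · exact (mul_le_mul_of_nonneg_right (min_le_left _ _) h0).trans (hk hks)
      · exact (mul_le_mul_of_nonneg_right (min_le_right _ _) h0).trans (hk' hkt)
    · intro y _
      by_cases hy : MapClusterPt y atTop x
      · obtain ⟨c, hc0, h⟩ := (hcl y hy).exists_le_deltaPhi hh hc hσu hκu
        exact ⟨_, nhdsWithin_le_nhds h, c, hc0, Eventually.of_forall fun k hk => hk⟩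
      -- Near a point that is not a cluster point the claim is eventually vacuous, so any constant
      -- works.
      · rw [mapClusterPt_iff_frequently] at hy
        push Not at hy
        obtain ⟨s, hs, h⟩ := hy
        exact ⟨s, nhdsWithin_le_nhds hs, 1, one_pos, h.mono fun k hk hks => absurd hks hk⟩
  obtain ⟨c, hc0, h⟩ := key
  exact ⟨c, hc0, h.mono fun k hk => hk (hx k)⟩

end Problem

end StochSQP

/-! ### Conditional Borel–Cantelli arguments. -/

namespace StochSQP

section Probability

variable {S : Type*} {m0 : MeasurableSpace S} {μ : Measure S} [IsProbabilityMeasure μ]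
  {ℱ : Filtration ℕ m0} {G : ℕ → Set S} {p : ℝ}

/-- If events have conditional probability larger than `1/2`, then the walk that goes up on these
events and down otherwise is not bounded above. -/
lemma ae_not_bddAbove_sum_indicator (hG : ∀ k, MeasurableSet[ℱ (k + 1)] (G k)) (hp : 1 / 2 < p)
    (hcond : ∀ k, ∀ᵐ ω ∂μ, p ≤ (μ[(G k).indicator (fun _ => (1 : ℝ)) | ℱ k]) ω) :
    ∀ᵐ ω ∂μ, ¬ BddAbove (Set.range fun N : ℕ =>
      ∑ k ∈ Finset.range N, ((G k).indicator (fun _ => (1 : ℝ)) ω - 1 / 2)) := by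
  -- Shifted by one, since `G k` is only known at time k + 1.
  let s : ℕ → Set S := fun k => Nat.casesOn k ∅ G
  have hs : ∀ k, MeasurableSet[ℱ k] (s k) := by
    rintro (_ | k)
    · exact @MeasurableSet.empty _ (ℱ 0)
    · exact hG k
  have hbd : ∀ᵐ ω ∂μ, ∀ i, ‖BorelCantelli.process s (i + 1) ω - BorelCantelli.process s i ω‖ ≤
      (1 : ℝ) := Eventually.of_forall fun ω i => by
    simpa using BorelCantelli.process_difference_le s ω i
  have h0 := martingalePart_bdd_difference ℱ hbd
  -- A martingale with bounded increments almost surely does not tend to -∞. A bound b on the walk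
  -- would force exactly that, because the martingale part is at most b + N(1/2 - p).
  have h1 := (martingale_martingalePart (BorelCantelli.stronglyAdapted_process hs)
    (BorelCantelli.integrable_process μ hs)).ae_not_tendsto_atTop_atBot (R := 2)
      (by simpa [Real.norm_eq_abs] using h0)
  filter_upwards [h1, ae_all_iff.2 hcond] with ω hω hc
  rintro ⟨b, hb⟩
  refine hω ?_
  have hlim : Tendsto (fun N : ℕ => b + (N : ℝ) * (1 / 2 - p)) atTop atBot :=
    tendsto_atBot_add_const_left _ _
      (tendsto_natCast_atTop_atTop.atTop_mul_const_of_neg (by linarith))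
  refine tendsto_atBot_mono (fun N => ?_) hlim
  have h2 := hb ⟨N, rfl⟩
  rw [BorelCantelli.martingalePart_process_ae_eq, Finset.sum_apply]
  have h3 : ∑ k ∈ Finset.range N, ((s (k + 1)).indicator (1 : S → ℝ) -
        μ[(s (k + 1)).indicator (1 : S → ℝ) | ℱ k]) ω ≤
      ∑ k ∈ Finset.range N, (((G k).indicator (fun _ => (1 : ℝ)) ω - 1 / 2) + (1 / 2 - p)) := by
    refine Finset.sum_le_sum fun k _ => ?_
    have := hc k
    change (G k).indicator (fun _ => (1 : ℝ)) ω -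
      (μ[(G k).indicator (fun _ => (1 : ℝ)) | ℱ k]) ω ≤ _
    linarith
  rw [Finset.sum_add_distrib, Finset.sum_const, Finset.card_range, nsmul_eq_mul] at h3
  simp only at h2
  linarith

/-- Events `B k` of the past that occur infinitely often are infinitely often followed by an event
`G k` whose conditional probability is bounded below. -/
lemma ae_frequently_inter {B : ℕ → Set S} (hB : ∀ k, MeasurableSet[ℱ k] (B k))
    (hG : ∀ k, MeasurableSet[ℱ (k + 1)] (G k)) (hp : 0 < p)
    (hcond : ∀ k, ∀ᵐ ω ∂μ, p ≤ (μ[(G k).indicator (fun _ => (1 : ℝ)) | ℱ k]) ω) :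
    ∀ᵐ ω ∂μ, (∃ᶠ k in atTop, ω ∈ B k) → ∃ᶠ k in atTop, ω ∈ B k ∩ G k := by
  let s : ℕ → Set S := fun k => Nat.casesOn k ∅ fun k => B k ∩ G k
  have hs : ∀ k, MeasurableSet[ℱ k] (s k) := by
    rintro (_ | k)
    · exact @MeasurableSet.empty _ (ℱ 0)
    · exact (ℱ.mono k.le_succ _ (hB k)).inter (hG k)
  -- The conditional probability of `B k ∩ G k` is at least p on `B k`, so these probabilities have
  -- a divergent sum when `B k` recurs, and Lévy's criterion applies.
  have hpull : ∀ k, μ[(s (k + 1)).indicator (1 : S → ℝ) | ℱ k] =ᵐ[μ]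
      (B k).indicator (μ[(G k).indicator (fun _ => (1 : ℝ)) | ℱ k]) := by
    intro k
    have : (s (k + 1)).indicator (1 : S → ℝ) =
        (B k).indicator ((G k).indicator (fun _ => (1 : ℝ))) := by
      rw [Set.indicator_indicator]; rfl
    rw [this]
    exact condExp_indicator ((integrable_const _).indicator (ℱ.le _ _ (hG k))) (hB k)
  filter_upwards [ae_mem_limsup_atTop_iff μ hs, ae_all_iff.2 hcond, ae_all_iff.2 hpull]
    with ω h1 h2 h3 hfr
  have h4 : Tendsto (fun N => ∑ k ∈ Finset.range N, (B k).indicator (fun _ => p) ω)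
      atTop atTop := by
    have h5 := Set.limsup_eq_tendsto_sum_indicator_atTop (R := ℝ) hp B
    have h6 : ω ∈ limsup B atTop := by
      rw [mem_limsup_iff_frequently_mem]; exact hfr
    rw [h5] at h6
    exact h6
  have h7 := h1.2 (tendsto_atTop_mono (fun N => Finset.sum_le_sum fun k _ => ?_) h4)
  · rw [mem_limsup_iff_frequently_mem] at h7
    rw [frequently_atTop] at h7 ⊢
    intro a
    obtain ⟨b, hb, hm⟩ := h7 (a + 1)
    obtain ⟨b, rfl⟩ := Nat.exists_eq_add_of_le' (Nat.one_le_of_lt hb)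
    exact ⟨b, by omega, hm⟩
  · rw [h3 k]
    by_cases hk : ω ∈ B k
    · simpa [hk] using h2 k
    · simp [hk]

/-- Iterated form of `ae_frequently_inter`: arbitrarily long runs of the events `G k`. -/
lemma ae_frequently_run (N : ℕ) {B : ℕ → Set S} (hB : ∀ k, MeasurableSet[ℱ k] (B k))
    (hG : ∀ k, MeasurableSet[ℱ (k + 1)] (G k)) (hp : 0 < p)
    (hcond : ∀ k, ∀ᵐ ω ∂μ, p ≤ (μ[(G k).indicator (fun _ => (1 : ℝ)) | ℱ k]) ω) :
    ∀ᵐ ω ∂μ, (∃ᶠ k in atTop, ω ∈ B k) →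
      ∃ᶠ k in atTop, ω ∈ B k ∧ ∀ i < N, ω ∈ G (k + i) := by
  induction N generalizing B with
  | zero => exact Eventually.of_forall fun ω h => by simpa using h
  | succ N ih =>
    -- The first good event is absorbed into the starting event one index later; the remaining N
    -- come from the induction hypothesis.
    let C : ℕ → Set S := fun k => Nat.casesOn k ∅ fun k => B k ∩ G k
    have hC : ∀ k, MeasurableSet[ℱ k] (C k) := by
      rintro (_ | k)
      · exact @MeasurableSet.empty _ (ℱ 0)
      · exact (ℱ.mono k.le_succ _ (hB k)).inter (hG k)
    filter_upwards [ih hC, ae_frequently_inter hB hG hp hcond] with ω h1 h2 hfr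
    have h3 := h2 hfr
    have h4 : ∃ᶠ k in atTop, ω ∈ C k := by
      rw [frequently_atTop] at h3 ⊢
      intro a
      obtain ⟨b, hb, hm⟩ := h3 a
      exact ⟨b + 1, by omega, hm⟩
    have h5 := h1 h4
    rw [frequently_atTop] at h5 ⊢
    intro a
    obtain ⟨b, hb, hm, hr⟩ := h5 (a + 1)
    obtain ⟨b, rfl⟩ := Nat.exists_eq_add_of_le' (Nat.one_le_of_lt hb)
    refine ⟨b, by omega, hm.1, ?_⟩
    rintro (_ | i) hi
    · exact hm.2
    · have := hr i (by omega)
      rwa [show b + 1 + i = b + (i + 1) by omega] at this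

/-- Conditional probability of the intersection of two successive events. -/
lemma ae_le_condExp_inter {m m' : MeasurableSpace S} (hmm' : m ≤ m') (hm' : m' ≤ m0)
    {I J : Set S} (hI : MeasurableSet[m'] I) (hJ : MeasurableSet[m0] J) {q : ℝ} (hp : 0 ≤ p)
    (hIq : ∀ᵐ ω ∂μ, q ≤ (μ[I.indicator (fun _ => (1 : ℝ)) | m]) ω)
    (hJp : ∀ᵐ ω ∂μ, p ≤ (μ[J.indicator (fun _ => (1 : ℝ)) | m']) ω) :
    ∀ᵐ ω ∂μ, p * q ≤ (μ[(I ∩ J).indicator (fun _ => (1 : ℝ)) | m]) ω := by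
  have hIi : Integrable (I.indicator (fun _ => (1 : ℝ))) μ :=
    (integrable_const _).indicator (hm' _ hI)
  have hJi : Integrable (J.indicator (fun _ => (1 : ℝ))) μ := (integrable_const _).indicator hJ
  have h1 : μ[(I ∩ J).indicator (fun _ => (1 : ℝ)) | m'] =ᵐ[μ]
      I.indicator (μ[J.indicator (fun _ => (1 : ℝ)) | m']) := by
    rw [← Set.indicator_indicator]
    exact condExp_indicator hJi hI
  -- I is known at the finer σ-algebra, so its indicator factors out there; the tower property then
  -- brings the bound down to `m`.
  have h2 : p • I.indicator (fun _ => (1 : ℝ)) ≤ᵐ[μ]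
      μ[(I ∩ J).indicator (fun _ => (1 : ℝ)) | m'] := by
    filter_upwards [h1, hJp] with ω ha hb
    rw [ha]
    by_cases hω : ω ∈ I
    · simpa [hω] using hb
    · simp [hω]
  have h3 := condExp_mono (m := m) (hIi.smul p) integrable_condExp h2
  filter_upwards [h3, condExp_condExp_of_le (f := (I ∩ J).indicator (fun _ => (1 : ℝ)))
    (μ := μ) hmm' hm', condExp_smul (μ := μ) p (I.indicator (fun _ => (1 : ℝ))) m, hIq]
    with ω ha hb hc hd
  rw [hb, hc] at ha
  exact (mul_le_mul_of_nonneg_left hd hp).trans ha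

end Probability

end StochSQP

/-! ### Measurability of the algorithm's quantities. -/

namespace StochSQP

variable {n m₁ m₂ : ℕ} {S : Type*}

lemma measurable_quadForm {m : MeasurableSpace S} {H : S → Matrix (Fin n) (Fin n) ℝ}
    {d : S → Vec n} (hH : ∀ p q, Measurable fun ω => H ω p q) (hd : Measurable d) :
    Measurable fun ω => quadForm (H ω) (d ω) := by
  have hdi : ∀ i, Measurable fun ω => WithLp.ofLp (d ω) i := fun i =>
    (measurable_pi_apply i).comp ((PiLp.continuous_ofLp 2 _).measurable.comp hd)
  simp only [quadForm, dotProduct, Matrix.mulVec]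
  exact Finset.measurable_sum _ fun i _ => (hdi i).mul
    (Finset.measurable_sum _ fun j _ => (hH i j).mul (hdi j))

namespace Run

variable (R : Run n S)

lemma past_le_halfPast (k : ℕ) : R.past k ≤ R.halfPast k := le_sup_left

lemma comap_le_past_succ (k : ℕ) :
    MeasurableSpace.comap (R.g k) inferInstance ⊔ MeasurableSpace.comap (R.f0 k) inferInstance ⊔
      MeasurableSpace.comap (R.fs k) inferInstance ≤ R.past (k + 1) :=
  le_iSup (fun i : Fin (k + 1) => MeasurableSpace.comap (R.g i) inferInstance ⊔
    MeasurableSpace.comap (R.f0 i) inferInstance ⊔ MeasurableSpace.comap (R.fs i) inferInstance)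
    (Fin.last k)

lemma past_le_past_succ (k : ℕ) : R.past k ≤ R.past (k + 1) :=
  iSup_le fun i => le_iSup (fun i : Fin (k + 1) => MeasurableSpace.comap (R.g i) inferInstance ⊔
    MeasurableSpace.comap (R.f0 i) inferInstance ⊔ MeasurableSpace.comap (R.fs i) inferInstance)
    i.castSucc

lemma halfPast_le_past_succ (k : ℕ) : R.halfPast k ≤ R.past (k + 1) :=
  sup_le (R.past_le_past_succ k)
    ((le_sup_left.trans le_sup_left).trans (R.comap_le_past_succ k))

lemma measurable_g (k : ℕ) : Measurable[R.halfPast k] (R.g k) :=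
  measurable_iff_comap_le.2 le_sup_right

lemma measurable_f0 (k : ℕ) : Measurable[R.past (k + 1)] (R.f0 k) :=
  measurable_iff_comap_le.2 ((le_sup_right.trans le_sup_left).trans (R.comap_le_past_succ k))

lemma measurable_fs (k : ℕ) : Measurable[R.past (k + 1)] (R.fs k) :=
  measurable_iff_comap_le.2 (le_sup_right.trans (R.comap_le_past_succ k))

section Step

variable (P : Problem n m₁ m₂) (A : Params) {k : ℕ}

lemma sigma_nonneg (ω : S) : 0 ≤ R.sigma P A k ω :=
  le_min A.σu_pos.le (mul_nonneg A.κu_pos.le (P.phi_nonneg _))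

variable {P A} {R}

lemma measurable_dPhi {m : MeasurableSpace S} (hh : ∀ i, ContDiff ℝ 1 (P.h i))
    (hc : ∀ j, ContDiff ℝ 1 (P.c j)) (hx : Measurable (R.x k)) : Measurable (R.dPhi P A k) := by
  have hσ : Continuous fun x => min A.σu (A.κu * P.phi x) :=
    continuous_const.min (continuous_const.mul (P.continuous_phi hh hc))
  exact (P.continuous_deltaPhi hh hc hσ fun x =>
    le_min A.σu_pos.le (mul_nonneg A.κu_pos.le (P.phi_nonneg _))).measurable.comp hx

lemma measurable_predRed {m : MeasurableSpace S} (hh : ∀ i, ContDiff ℝ 1 (P.h i))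
    (hc : ∀ j, ContDiff ℝ 1 (P.c j)) (hx : Measurable (R.x k)) (hg : Measurable (R.g k))
    (hd : Measurable (R.d k)) {ρ : S → ℝ} (hρ : Measurable ρ) :
    Measurable fun ω => R.predRed P A k ω (ρ ω) :=
  (hg.inner hd).neg.add (hρ.mul (measurable_dPhi hh hc hx))

lemma measurableSet_success {m : MeasurableSpace S} (hh : ∀ i, ContDiff ℝ 1 (P.h i))
    (hc : ∀ j, ContDiff ℝ 1 (P.c j)) (hx : Measurable (R.x k)) (hg : Measurable (R.g k))
    (hd : Measurable (R.d k)) (hα : Measurable (R.α k)) (hρ : Measurable (R.ρ (k + 1)))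
    (hf0 : Measurable (R.f0 k)) (hfs : Measurable (R.fs k)) :
    MeasurableSet {ω | R.Success P A k ω} := by
  have hphi := (P.continuous_phi hh hc).measurable
  exact measurableSet_le ((measurable_const.mul hα).mul (measurable_predRed hh hc hx hg hd hρ))
    ((hf0.add (hρ.mul (hphi.comp hx))).sub
      (hfs.add (hρ.mul (hphi.comp (hx.add (hα.smul hd))))))

lemma measurableSet_penaltyOk {m : MeasurableSpace S} (hh : ∀ i, ContDiff ℝ 1 (P.h i))
    (hc : ∀ j, ContDiff ℝ 1 (P.c j)) (hx : Measurable (R.x k)) (hg : Measurable (R.g k))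
    (hd : Measurable (R.d k)) (hρ : Measurable (R.ρ k))
    (hQ : Measurable fun ω => quadForm (R.H k ω) (R.d k ω)) :
    MeasurableSet {ω | R.PenaltyOk P A k ω} :=
  measurableSet_le (hQ.div_const 2) (measurable_predRed hh hc hx hg hd hρ)

lemma measurableSet_gradAcc {m : MeasurableSpace S} (hf : ContDiff ℝ 1 P.f) (κg : ℝ)
    (hx : Measurable (R.x k)) (hg : Measurable (R.g k)) (hd : Measurable (R.d k))
    (hα : Measurable (R.α k)) : MeasurableSet (R.gradAcc P κg k) :=
  measurableSet_le (hg.sub ((continuous_gradient hf).measurable.comp hx)).norm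
    ((hα.const_mul κg).mul hd.norm)

lemma measurableSet_funAcc {m : MeasurableSpace S} (hf : ContDiff ℝ 1 P.f) (εf : ℝ)
    (hx : Measurable (R.x k)) (hd : Measurable (R.d k)) (hα : Measurable (R.α k))
    (hf0 : Measurable (R.f0 k)) (hfs : Measurable (R.fs k)) :
    MeasurableSet (R.funAcc P εf k) := by
  have hfm := hf.continuous.measurable
  have hrhs := ((hα.pow_const 2).const_mul εf).mul (hd.norm.pow_const 2)
  exact (measurableSet_le (Measurable.abs (hf0.sub (hfm.comp hx))) hrhs).inter
    (measurableSet_le (Measurable.abs (hfs.sub (hfm.comp (hx.add (hα.smul hd))))) hrhs)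

end Step

variable {R} {P : Problem n m₁ m₂} {A : Params} {x₀ : Vec n} [MeasurableSpace S]

/-- The update of ρ uses g_k and d_k but no function estimates, so it is settled half a step before
the iterate and the step size. -/
lemma IsGenerated.measurable_rho_succ (hR : R.IsGenerated P A x₀)
    (hh : ∀ i, ContDiff ℝ 1 (P.h i)) (hc : ∀ j, ContDiff ℝ 1 (P.c j)) {k : ℕ}
    (hx : Measurable[R.past k] (R.x k)) (hρ : Measurable[R.past k] (R.ρ k)) :
    Measurable[R.halfPast k] (R.ρ (k + 1)) := by
  classical
  have hle := R.past_le_halfPast k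
  have hx := hx.mono hle le_rfl
  have hρ := hρ.mono hle le_rfl
  have hg := R.measurable_g k
  have hd := hR.d_meas k
  have hQ := measurable_quadForm (fun p q => (hR.H_meas k p q).mono hle le_rfl) hd
  have hok : MeasurableSet[R.halfPast k] {ω | R.PenaltyOk P A k ω} :=
    measurableSet_penaltyOk hh hc hx hg hd hρ hQ
  have heq : R.ρ (k + 1) = fun ω => if R.PenaltyOk P A k ω then R.ρ k ω else
      max (R.qpObj k ω (R.d k ω) / R.dPhi P A k ω) (2 * R.ρ k ω) := by
    funext ω
    split_ifs with h
    · exact hR.penalty_keep k ω h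
    · exact hR.penalty_raise k ω h
  rw [heq]
  exact Measurable.ite hok hρ (((Measurable.add (hg.inner hd) (hQ.div_const 2)).div
    (measurable_dPhi hh hc hx)).max (hρ.const_mul 2))

/-- The iterates, step sizes and penalty parameters are determined by the past. -/
lemma IsGenerated.measurable_past (hR : R.IsGenerated P A x₀)
    (hh : ∀ i, ContDiff ℝ 1 (P.h i)) (hc : ∀ j, ContDiff ℝ 1 (P.c j)) (k : ℕ) :
    Measurable[R.past k] (R.x k) ∧ Measurable[R.past k] (R.α k) ∧
      Measurable[R.past k] (R.ρ k) := by
  classical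
  induction k with
  | zero =>
    rw [show R.x 0 = fun _ => x₀ from funext hR.x_init,
      show R.α 0 = fun _ => A.γ ^ A.j0 * A.αmax from funext hR.α_init,
      show R.ρ 0 = fun _ => A.ρ0 from funext hR.ρ_init]
    exact ⟨measurable_const, measurable_const, measurable_const⟩
  | succ k ih =>
    obtain ⟨hx, hα, hρ⟩ := ih
    have hρ' := (hR.measurable_rho_succ hh hc hx hρ).mono (R.halfPast_le_past_succ k) le_rfl
    have hle := R.past_le_past_succ k
    have hx := hx.mono hle le_rfl
    have hα := hα.mono hle le_rfl
    have hg := (R.measurable_g k).mono (R.halfPast_le_past_succ k) le_rfl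
    have hd := (hR.d_meas k).mono (R.halfPast_le_past_succ k) le_rfl
    have hS : MeasurableSet[R.past (k + 1)] {ω | R.Success P A k ω} :=
      measurableSet_success hh hc hx hg hd hα hρ' (R.measurable_f0 k) (R.measurable_fs k)
    have hxe : R.x (k + 1) = fun ω => if R.Success P A k ω then R.trial k ω else R.x k ω := by
      funext ω
      split_ifs with h
      · exact (hR.success k ω h).1
      · exact (hR.failure k ω h).1
    have hαe : R.α (k + 1) = fun ω => if R.Success P A k ω then min (A.γ * R.α k ω) A.αmax
        else A.γ⁻¹ * R.α k ω := by
      funext ω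
      split_ifs with h
      · exact (hR.success k ω h).2
      · exact (hR.failure k ω h).2
    refine ⟨?_, ?_, hρ'⟩
    · rw [hxe]
      exact Measurable.ite hS (hx.add (hα.smul hd)) hx
    · rw [hαe]
      exact Measurable.ite hS ((hα.const_mul _).min measurable_const) (hα.const_mul _)

lemma IsGenerated.past_le (hR : R.IsGenerated P A x₀) (k : ℕ) :
    R.past k ≤ (inferInstance : MeasurableSpace S) :=
  iSup_le fun i => sup_le (sup_le (hR.g_meas i).comap_le (hR.f0_meas i).comap_le)
    (hR.fs_meas i).comap_le

/-- The filtration `𝓕_{k-1}`. -/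
def IsGenerated.filtration (hR : R.IsGenerated P A x₀) :
    Filtration ℕ (inferInstance : MeasurableSpace S) where
  seq := R.past
  mono' := monotone_nat_of_le_succ R.past_le_past_succ
  le' := hR.past_le

lemma IsGenerated.measurableSet_gradAcc (hR : R.IsGenerated P A x₀) (hf : ContDiff ℝ 1 P.f)
    (hh : ∀ i, ContDiff ℝ 1 (P.h i)) (hc : ∀ j, ContDiff ℝ 1 (P.c j)) (κg : ℝ) (k : ℕ) :
    MeasurableSet[R.halfPast k] (R.gradAcc P κg k) := by
  obtain ⟨hx, hα, -⟩ := hR.measurable_past hh hc k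
  have hx := hx.mono (R.past_le_halfPast k) le_rfl
  have hα := hα.mono (R.past_le_halfPast k) le_rfl
  exact Run.measurableSet_gradAcc hf κg hx (R.measurable_g k) (hR.d_meas k) hα

lemma IsGenerated.measurableSet_funAcc (hR : R.IsGenerated P A x₀) (hf : ContDiff ℝ 1 P.f)
    (hh : ∀ i, ContDiff ℝ 1 (P.h i)) (hc : ∀ j, ContDiff ℝ 1 (P.c j)) (εf : ℝ) (k : ℕ) :
    MeasurableSet[R.past (k + 1)] (R.funAcc P εf k) := by
  obtain ⟨hx, hα, -⟩ := hR.measurable_past hh hc k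
  have hx := hx.mono (R.past_le_past_succ k) le_rfl
  have hα := hα.mono (R.past_le_past_succ k) le_rfl
  have hd := (hR.d_meas k).mono (R.halfPast_le_past_succ k) le_rfl
  exact Run.measurableSet_funAcc hf εf hx hd hα (R.measurable_f0 k) (R.measurable_fs k)

/-- Monitoring only replaces the probability by some `A.a j`, which is at least `A.a 0`, so one
constant serves all iterations. -/
lemma IsGenerated.pg0_le (hR : R.IsGenerated P A x₀) (k : ℕ) (ω : S) : A.pg0 ≤ R.pg k ω := by
  induction k with
  | zero => exact (hR.pg_init ω).ge
  | succ k ih =>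
    rcases lt_or_ge (R.ζ k ω) ‖R.g k ω‖ with h | h
    · rw [(hR.large k ω h).2.1]
      exact A.a_zero.trans (A.a_mono (Nat.zero_le _))
    · rwa [(hR.small k ω h).2.1]

lemma IsGenerated.ae_le_condExp_good (hR : R.IsGenerated P A x₀) (hf : ContDiff ℝ 1 P.f)
    (hh : ∀ i, ContDiff ℝ 1 (P.h i)) (hc : ∀ j, ContDiff ℝ 1 (P.c j))
    {μ : Measure S} [IsProbabilityMeasure μ] {κg εf : ℝ} (h2 : R.ProbAccurate P A μ κg εf)
    (k : ℕ) :
    ∀ᵐ ω ∂μ, A.pf * A.pg0 ≤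
      (μ[(R.gradAcc P κg k ∩ R.funAcc P εf k).indicator (fun _ => (1 : ℝ)) | R.past k]) ω :=
  ae_le_condExp_inter (R.past_le_halfPast k) ((R.halfPast_le_past_succ k).trans (hR.past_le _))
    (hR.measurableSet_gradAcc hf hh hc κg k)
    (hR.past_le _ _ (hR.measurableSet_funAcc hf hh hc εf k)) A.pf_pos.le
    ((h2.grad k).mono fun ω hω => (hR.pg0_le k ω).trans hω) (h2.func k)

end Run

end StochSQP

/-! ### Deterministic estimates for a single iteration. -/

namespace StochSQP

variable {n m₁ m₂ : ℕ} {S : Type*}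

namespace Problem

variable (P : Problem n m₁ m₂)

lemma chi_nonneg (βl : ℝ) (hβ : 0 ≤ βl) (x : Vec n) : 0 ≤ P.chi βl x := by
  rw [chi, neg_nonneg]
  by_cases hb : BddBelow ((fun t : Vec n => ⟪∇ P.f x, t⟫) ''
    {t | (∀ i, ⟪∇ (P.h i) x, t⟫ = 0) ∧ (∀ j, ⟪∇ (P.c j) x, t⟫ ≤ 0) ∧ supNorm t ≤ βl / 2})
  · refine csInf_le hb ⟨0, ⟨?_, ?_, ?_⟩, inner_zero_right _⟩
    · simp
    · simp
    · rw [supNorm_zero]; positivity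
  -- Here the infimum is 0 by convention, so compactness of the feasible set need not be invoked.
  · exact (Real.sInf_of_not_bddBelow hb).le

lemma chi_le {βl : ℝ} (hβ : 0 ≤ βl) {x : Vec n} {r : ℝ}
    (h : ∀ t : Vec n, (∀ i, ⟪∇ (P.h i) x, t⟫ = 0) → (∀ j, ⟪∇ (P.c j) x, t⟫ ≤ 0) →
      supNorm t ≤ βl / 2 → -⟪∇ P.f x, t⟫ ≤ r) : P.chi βl x ≤ r := by
  rw [chi, neg_le]
  refine le_csInf ⟨_, 0, ⟨?_, ?_, ?_⟩, rfl⟩ ?_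
  · simp
  · simp
  · rw [supNorm_zero]; positivity
  · rintro _ ⟨t, ⟨h1, h2, h3⟩, rfl⟩
    linarith [h t h1 h2 h3]

/-- Decrease of the infeasibility along a step whose linearized infeasibility is at most `κ`. -/
lemma phi_add_smul_le (hh : ∀ i, ContDiff ℝ 1 (P.h i)) (hc : ∀ j, ContDiff ℝ 1 (P.c j))
    {Om : Set (Vec n)} {Lh : Fin m₁ → ℝ} {Lc : Fin m₂ → ℝ}
    (hLh : ∀ i, ∀ x ∈ Om, ∀ y ∈ Om, ‖∇ (P.h i) x - ∇ (P.h i) y‖ ≤ Lh i * ‖x - y‖)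
    (hLc : ∀ j, ∀ x ∈ Om, ∀ y ∈ Om, ‖∇ (P.c j) x - ∇ (P.c j) y‖ ≤ Lc j * ‖x - y‖)
    {x d : Vec n} {α κ : ℝ} (hα : 0 ≤ α) (hα1 : α ≤ 1)
    (hseg : ∀ t ∈ Set.Icc 0 α, x + t • d ∈ Om) (hκ : 0 ≤ κ) (hd : P.linPhi x d ≤ κ) :
    P.phi (x + α • d) ≤ P.phi x - α * (P.phi x - κ) +
      (∑ i, |Lh i| + ∑ j, |Lc j|) * α ^ 2 * ‖d‖ ^ 2 := by
  set L := ∑ i, |Lh i| + ∑ j, |Lc j|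
  have hsh : 0 ≤ ∑ i, |Lh i| := Finset.sum_nonneg fun _ _ => abs_nonneg _
  have hsc : 0 ≤ ∑ j, |Lc j| := Finset.sum_nonneg fun _ _ => abs_nonneg _
  have hLhi : ∀ i, |Lh i| ≤ L := fun i =>
    (Finset.single_le_sum (f := fun i => |Lh i|) (fun _ _ => abs_nonneg _)
      (Finset.mem_univ i)).trans (le_add_of_nonneg_right hsc)
  have hLcj : ∀ j, |Lc j| ≤ L := fun j =>
    (Finset.single_le_sum (f := fun j => |Lc j|) (fun _ _ => abs_nonneg _)
      (Finset.mem_univ j)).trans (le_add_of_nonneg_left hsh)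
  have hL0 : 0 ≤ L := add_nonneg hsh hsc
  have hq : 0 ≤ α ^ 2 * ‖d‖ ^ 2 := by positivity
  have hφ := P.phi_nonneg x
  have hr : 0 ≤ P.phi x - α * (P.phi x - κ) + L * α ^ 2 * ‖d‖ ^ 2 := by
    have h1 : 0 ≤ (1 - α) * P.phi x := mul_nonneg (by linarith) hφ
    have h2 : 0 ≤ α * κ := mul_nonneg hα hκ
    have h3 : 0 ≤ L * (α ^ 2 * ‖d‖ ^ 2) := mul_nonneg hL0 hq
    nlinarith
  obtain ⟨hd1, hd2⟩ := (P.linPhi_le_iff hκ).1 hd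
  -- Up to the Taylor error, each constraint at the new point is the convex combination, with
  -- weights 1 - α and α, of its value and its linearization.
  refine (P.phi_le_iff hr).2 ⟨fun i => ?_, fun j => ?_⟩
  · have h1 := abs_le.1 (abs_taylor_le (hh i) (hLh i) hα hseg)
    have h2 := mul_le_mul_of_nonneg_right (hLhi i) hq
    have h3 := abs_le.1 (hd1 i)
    have h4 := abs_le.1 (P.abs_h_le_phi x i)
    have h5 := mul_le_mul_of_nonneg_left h3.1 hα
    have h6 := mul_le_mul_of_nonneg_left h3.2 hα
    have h7 := mul_le_mul_of_nonneg_left h4.1 (sub_nonneg.2 hα1)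
    have h8 := mul_le_mul_of_nonneg_left h4.2 (sub_nonneg.2 hα1)
    rw [abs_le]
    constructor <;> linarith
  · have h1 := abs_le.1 (abs_taylor_le (hc j) (hLc j) hα hseg)
    have h2 := mul_le_mul_of_nonneg_right (hLcj j) hq
    have h6 := mul_le_mul_of_nonneg_left (hd2 j) hα
    have h8 := mul_le_mul_of_nonneg_left (P.c_le_phi x j) (sub_nonneg.2 hα1)
    linarith

end Problem

namespace Run

variable {R : Run n S} {P : Problem n m₁ m₂} {A : Params} {x₀ : Vec n} [MeasurableSpace S]

namespace IsGenerated

lemma alpha_mem (hR : R.IsGenerated P A x₀) (k : ℕ) (ω : S) :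
    0 < R.α k ω ∧ R.α k ω ≤ A.αmax := by
  have hγ := A.γ_gt
  have hα := A.αmax_pos
  have hγ0 : 0 < A.γ := by linarith
  induction k with
  | zero =>
    rw [hR.α_init]
    refine ⟨by positivity, mul_le_of_le_one_left hα.le (zpow_le_one_of_nonpos₀ hγ.le A.j0_neg.le)⟩
  | succ k ih =>
    by_cases h : R.Success P A k ω
    · rw [(hR.success k ω h).2]
      exact ⟨lt_min (mul_pos hγ0 ih.1) hα, min_le_right _ _⟩
    · rw [(hR.failure k ω h).2]
      exact ⟨mul_pos (inv_pos.2 hγ0) ih.1,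
        (mul_le_of_le_one_left ih.1.le (inv_le_one_of_one_le₀ hγ.le)).trans ih.2⟩

lemma inv_mul_alpha_le (hR : R.IsGenerated P A x₀) (k : ℕ) (ω : S) :
    A.γ⁻¹ * R.α k ω ≤ R.α (k + 1) ω := by
  by_cases h : R.Success P A k ω
  · obtain ⟨h0, h1⟩ := hR.alpha_mem k ω
    have hγ := A.γ_gt
    have h2 : A.γ⁻¹ * R.α k ω ≤ R.α k ω :=
      mul_le_of_le_one_left h0.le (inv_le_one_of_one_le₀ hγ.le)
    rw [(hR.success k ω h).2]
    exact h2.trans (le_min (le_mul_of_one_le_left h0.le hγ.le) h1)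
  · exact (hR.failure k ω h).2.ge

lemma rho0_le (hR : R.IsGenerated P A x₀) (k : ℕ) (ω : S) : A.ρ0 ≤ R.ρ k ω := by
  induction k with
  | zero => exact (hR.ρ_init ω).ge
  | succ k ih =>
    by_cases h : R.PenaltyOk P A k ω
    · rwa [hR.penalty_keep k ω h]
    · rw [hR.penalty_raise k ω h]
      refine le_max_of_le_right ?_
      linarith [A.ρ0_pos]

lemma rho_mono (hR : R.IsGenerated P A x₀) (ω : S) : Monotone fun k => R.ρ k ω := by
  refine monotone_nat_of_le_succ fun k => ?_
  by_cases h : R.PenaltyOk P A k ω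
  · exact (hR.penalty_keep k ω h).ge
  · rw [hR.penalty_raise k ω h]
    refine le_max_of_le_right ?_
    linarith [A.ρ0_pos, hR.rho0_le k ω]

lemma linPhi_d_le_and (hR : R.IsGenerated P A x₀) (k : ℕ) (ω : S) :
    P.linPhi (R.x k ω) (R.d k ω) ≤ P.kappa (R.x k ω) (R.sigma P A k ω) ∧
      supNorm (R.d k ω) ≤ R.β k ω :=
  (P.mem_qpFeasible_iff (P.kappa_nonneg _ _)).1 (hR.d_mem k ω)

/-- If the penalty parameter is bounded at the iterations where it is raised, then it is eventually
constant. -/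
lemma eventually_penaltyOk (hR : R.IsGenerated P A x₀) {ω : S} {C : ℝ}
    (hC : ∀ᶠ k in atTop, ¬ R.PenaltyOk P A k ω → R.ρ k ω ≤ C) :
    ∀ᶠ k in atTop, R.PenaltyOk P A k ω := by
  by_contra hcon
  rw [not_eventually] at hcon
  -- By monotonicity, ρ at any index is bounded by its value at a later raise.
  have hbd : ∀ k, R.ρ k ω ≤ C := fun k => by
    obtain ⟨l, ⟨h1, h2⟩, h3⟩ := ((hcon.and_eventually hC).and_eventually
      (eventually_ge_atTop k)).exists
    exact (hR.rho_mono ω h3).trans (h2 h1)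
  obtain ⟨l, hl⟩ : ∃ l, Tendsto (fun k => R.ρ k ω) atTop (nhds l) :=
    ⟨_, tendsto_atTop_ciSup (hR.rho_mono ω) ⟨C, by rintro _ ⟨k, rfl⟩; exact hbd k⟩⟩
  -- Increments tend to zero, whereas each raise adds at least ρ_k ≥ ρ_0.
  have hdiff : Tendsto (fun k => R.ρ (k + 1) ω - R.ρ k ω) atTop (nhds 0) := by
    simpa using ((tendsto_add_atTop_iff_nat 1).2 hl).sub hl
  obtain ⟨k, h1, h2⟩ := (hcon.and_eventually (hdiff.eventually_lt_const A.ρ0_pos)).exists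
  rw [hR.penalty_raise k ω h1] at h2
  linarith [le_max_right (R.qpObj k ω (R.d k ω) / R.dPhi P A k ω) (2 * R.ρ k ω), hR.rho0_le k ω]

/-- Boundedness of the gradient estimates bounds the penalty parameter where it is raised. -/
lemma rho_le_of_not_penaltyOk (hR : R.IsGenerated P A x₀) {ω : S} {k : ℕ} {MH c Gb Φ : ℝ}
    (hH : ∀ d : Vec n, quadForm (R.H k ω) d ≤ MH * ‖d‖ ^ 2) (hMH : 0 ≤ MH) (hc : 0 < c)
    (hcφ : c * P.phi (R.x k ω) ≤ R.dPhi P A k ω) (hg : ‖R.g k ω‖ ≤ Gb)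
    (hΦ : P.phi (R.x k ω) ≤ Φ) (hfail : ¬ R.PenaltyOk P A k ω) :
    R.ρ k ω ≤ (Gb * (√n * A.κu) + MH * ((√n * A.κu) ^ 2 * Φ)) / c := by
  set φ := P.phi (R.x k ω) with hφ
  have hφ0 : 0 ≤ φ := P.phi_nonneg _
  have hσ0 := R.sigma_nonneg P A (k := k) ω
  -- The minimizer p is feasible for the subproblem, and the radius κ_u φ makes its objective O(φ).
  -- A failed test gives ρ Δ_φ < O(φ), while Δ_φ ≥ cφ.
  obtain ⟨p, hp, hpκ⟩ := P.exists_linPhi_eq_kappa (R.x k ω) hσ0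
  have hβ := (hR.β_mem k ω).1
  have hσu : R.sigma P A k ω ≤ A.σu := min_le_left _ _
  have hpq : p ∈ R.qpSet P A k ω :=
    (P.mem_qpFeasible_iff (P.kappa_nonneg _ _)).2
      ⟨hpκ.le, by linarith [A.σu_βl, A.σu_pos]⟩
  have hmin : R.qpObj k ω (R.d k ω) ≤ R.qpObj k ω p := hR.d_min k ω hpq
  set K := √n * A.κu with hK
  have hK0 : 0 ≤ K := mul_nonneg (Real.sqrt_nonneg _) A.κu_pos.le
  have hpn : ‖p‖ ≤ K * φ := by
    refine (norm_le_supNorm p).trans ?_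
    rw [hK, mul_assoc]
    exact mul_le_mul_of_nonneg_left (hp.trans (min_le_right _ _)) (Real.sqrt_nonneg _)
  have hGb : 0 ≤ Gb := (norm_nonneg _).trans hg
  have h1 : ⟪R.g k ω, p⟫ ≤ Gb * (K * φ) :=
    (real_inner_le_norm _ _).trans (mul_le_mul hg hpn (norm_nonneg _) hGb)
  have h2 : quadForm (R.H k ω) p ≤ MH * (K ^ 2 * Φ * φ) := by
    refine (hH p).trans (mul_le_mul_of_nonneg_left ?_ hMH)
    calc ‖p‖ ^ 2 ≤ (K * φ) ^ 2 := pow_le_pow_left₀ (norm_nonneg _) hpn 2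
      _ = K ^ 2 * (φ * φ) := by ring
      _ ≤ K ^ 2 * (Φ * φ) := by gcongr
      _ = K ^ 2 * Φ * φ := by ring
  have h2' : 0 ≤ MH * (K ^ 2 * Φ * φ) := by
    have : 0 ≤ Φ := hφ0.trans hΦ
    positivity
  set B := Gb * K + MH * (K ^ 2 * Φ) with hB
  have hB0 : 0 ≤ B := by
    have : 0 ≤ Φ := hφ0.trans hΦ
    positivity
  have h3 : R.qpObj k ω p ≤ B * φ := by
    rw [qpObj, hB]; linarith
  have h4 : R.ρ k ω * R.dPhi P A k ω < R.qpObj k ω (R.d k ω) := by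
    rw [PenaltyOk, predRed, not_le] at hfail
    rw [qpObj]; linarith
  rw [le_div_iff₀ hc]
  by_contra hcon
  rw [not_le] at hcon
  have hρ : 0 ≤ R.ρ k ω := A.ρ0_pos.le.trans (hR.rho0_le k ω)
  have h5 := mul_le_mul_of_nonneg_left hcφ hρ
  have h6 := mul_le_mul_of_nonneg_right hcon.le hφ0
  linarith

/-- An accurate iteration with a small step size is successful. -/
lemma success_of_good (hR : R.IsGenerated P A x₀) {μ : Measure S} {Om : Set (Vec n)} {Lf : ℝ}
    {Lh : Fin m₁ → ℝ} {Lc : Fin m₂ → ℝ} {ξ MH : ℝ} (h1 : R.Regular P μ Om Lf Lh Lc ξ MH)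
    {ω : S} {k : ℕ} (hmem : ∀ α ∈ Set.Icc 0 (R.α k ω), R.x k ω + α • R.d k ω ∈ Om)
    (hH : ∀ d : Vec n, 2 * ξ * ‖d‖ ^ 2 ≤ quadForm (R.H k ω) d) (hok : R.PenaltyOk P A k ω)
    {κg εf : ℝ} (hI : ω ∈ R.gradAcc P κg k) (hJ : ω ∈ R.funAcc P εf k) (hα1 : R.α k ω ≤ 1)
    (hα : R.α k ω * (κg + |Lf| + 2 * εf + R.ρ k ω * (∑ i, |Lh i| + ∑ j, |Lc j|)) ≤
      (1 - A.θ) * ξ) :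
    R.Success P A k ω := by
  obtain ⟨hα0, -⟩ := hR.alpha_mem k ω
  have hρ0 : 0 ≤ R.ρ k ω := A.ρ0_pos.le.trans (hR.rho0_le k ω)
  set L := ∑ i, |Lh i| + ∑ j, |Lc j|
  have hφ := P.phi_add_smul_le h1.h_smooth h1.c_smooth h1.h_lip h1.c_lip hα0.le hα1 hmem
    (P.kappa_nonneg _ _) (hR.linPhi_d_le_and k ω).1
  have hf := abs_le.1 (abs_taylor_le h1.f_smooth h1.f_lip hα0.le hmem)
  have hJ1 := abs_le.1 hJ.1
  have hJ2 := abs_le.1 hJ.2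
  have hI' : ⟪∇ P.f (R.x k ω), R.d k ω⟫ - ⟪R.g k ω, R.d k ω⟫ ≤
      κg * R.α k ω * ‖R.d k ω‖ * ‖R.d k ω‖ := by
    rw [← inner_sub_left]
    refine (real_inner_le_norm _ _).trans (mul_le_mul_of_nonneg_right ?_ (norm_nonneg _))
    rw [norm_sub_rev]; exact hI
  rw [Success, hR.penalty_keep k ω hok]
  have hΔ : ξ * ‖R.d k ω‖ ^ 2 ≤ R.predRed P A k ω (R.ρ k ω) :=
    le_trans (by linarith [hH (R.d k ω)]) hok
  -- All errors are multiples of α²‖d‖²: gradient, Taylor for f, two function estimates, Taylor for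
  -- φ. Together they fit into the slack (1 - θ)α times the predicted reduction, which is at least
  -- ξ‖d‖².
  have e1 := mul_le_mul_of_nonneg_left hφ hρ0
  have e2 := mul_le_mul_of_nonneg_left hI' hα0.le
  have e3 := mul_le_mul_of_nonneg_right hα
    (mul_nonneg hα0.le (sq_nonneg ‖R.d k ω‖))
  have e4 := mul_le_mul_of_nonneg_left hΔ
    (mul_nonneg hα0.le (sub_nonneg.2 A.θ_lt.le))
  have e5 : R.predRed P A k ω (R.ρ k ω) = -⟪R.g k ω, R.d k ω⟫ +
    R.ρ k ω * (P.phi (R.x k ω) - P.kappa (R.x k ω) (R.sigma P A k ω)) := rfl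
  have e6 : A.θ * R.α k ω * R.predRed P A k ω (R.ρ k ω) =
      R.α k ω * R.predRed P A k ω (R.ρ k ω) -
        R.α k ω * (1 - A.θ) * R.predRed P A k ω (R.ρ k ω) := by ring
  have e7 : R.α k ω * R.predRed P A k ω (R.ρ k ω) = R.α k ω * (-⟪R.g k ω, R.d k ω⟫ +
    R.ρ k ω * (P.phi (R.x k ω) - P.kappa (R.x k ω) (R.sigma P A k ω))) := by rw [e5]
  rw [e6, e7]
  change _ ≤ (R.f0 k ω + R.ρ k ω * P.phi (R.x k ω)) -
      (R.fs k ω + R.ρ k ω * P.phi (R.x k ω + R.α k ω • R.d k ω))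
  have j1 : R.fs k ω - P.f (R.x k ω + R.α k ω • R.d k ω) ≤
    εf * R.α k ω ^ 2 * ‖R.d k ω‖ ^ 2 := hJ2.2
  nlinarith [hJ1.1, hf.2]

/-- A successful step with accurate function estimates decreases the merit function. -/
lemma merit_decrease (hR : R.IsGenerated P A x₀) {ω : S} {k : ℕ} {ξ : ℝ}
    (hH : ∀ d : Vec n, 2 * ξ * ‖d‖ ^ 2 ≤ quadForm (R.H k ω) d) (hok : R.PenaltyOk P A k ω)
    {εf : ℝ} (hε : εf < ξ * A.θ / (4 * A.αmax)) (hεf : 0 < εf) (hJ : ω ∈ R.funAcc P εf k)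
    (hs : R.Success P A k ω) :
    P.f (R.x (k + 1) ω) + R.ρ k ω * P.phi (R.x (k + 1) ω) ≤
      P.f (R.x k ω) + R.ρ k ω * P.phi (R.x k ω) -
        ξ * A.θ / 2 * R.α k ω * ‖R.d k ω‖ ^ 2 := by
  obtain ⟨hα0, hαm⟩ := hR.alpha_mem k ω
  rw [(hR.success k ω hs).1]
  rw [Success, hR.penalty_keep k ω hok] at hs
  have hΔ : ξ * ‖R.d k ω‖ ^ 2 ≤ R.predRed P A k ω (R.ρ k ω) :=
    le_trans (by linarith [hH (R.d k ω)]) hok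
  have hJ1 := (abs_le.1 hJ.1).2
  have hJ2 := (abs_le.1 hJ.2).1
  have e1 := mul_le_mul_of_nonneg_left hΔ (mul_nonneg A.θ_pos.le hα0.le)
  rw [lt_div_iff₀ (by linarith [A.αmax_pos])] at hε
  -- Two estimation errors thus consume at most half of the guaranteed θξα‖d‖².
  have e2 : εf * R.α k ω ≤ ξ * A.θ / 4 := by
    have := mul_le_mul_of_nonneg_left hαm hεf.le
    linarith
  have e3 := mul_le_mul_of_nonneg_right e2 (mul_nonneg hα0.le (sq_nonneg ‖R.d k ω‖))
  nlinarith

/-- Away from stationarity, accurate iterations have search directions bounded away from zero. -/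
lemma exists_le_norm_d (hR : R.IsGenerated P A x₀) {ξ MH κg c G ε : ℝ} (hκg : 0 < κg)
    (hξ : 0 < ξ) (hMH : 0 < MH) (hc : 0 < c) (hG : 0 ≤ G) (hε : 0 < ε) :
    ∃ δ > 0, ∀ k ω, (∀ d : Vec n, 2 * ξ * ‖d‖ ^ 2 ≤ quadForm (R.H k ω) d ∧
        quadForm (R.H k ω) d ≤ MH * ‖d‖ ^ 2) →
      (∀ i, ‖∇ (P.h i) (R.x k ω)‖ ≤ G) → (∀ j, ‖∇ (P.c j) (R.x k ω)‖ ≤ G) →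
      c * P.phi (R.x k ω) ≤ R.dPhi P A k ω → ω ∈ R.gradAcc P κg k →
      ε ≤ R.optMeasure P A k ω → δ ≤ ‖R.d k ω‖ := by
  have hβ : 0 < A.βl := by linarith [A.σu_βl, A.σu_pos]
  set T := √n * (A.βl / 2) with hT
  have hT0 : 0 ≤ T := by positivity
  set C := MH * (1 + T) ^ 2 / 2 + κg * A.αmax * T with hC
  have hαm := A.αmax_pos
  have hC0 : 0 ≤ C := by positivity
  -- δ is both the threshold for ‖d‖ and the length of the test step along t. A shorter d would give
  -- φ ≤ (G/c)δ and χ ≤ Cδ, hence an optimality measure of at most ε/2.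
  obtain ⟨δ, ⟨hδ1, hδβ, hδε⟩, hδ0⟩ : ∃ δ : ℝ, (δ * 1 ≤ 1 ∧ δ * 1 ≤ A.βl / 2 ∧
      δ * ((G / c) ^ 2 + C ^ 2) ≤ ε / 2) ∧ 0 < δ :=
    (((eventually_mul_le 1 one_pos).and ((eventually_mul_le 1 (by positivity)).and
      (eventually_mul_le _ (by positivity)))).and self_mem_nhdsWithin).exists
  rw [mul_one] at hδ1 hδβ
  refine ⟨δ, hδ0, fun k ω hH hGh hGc hcφ hI hopt => ?_⟩
  by_contra hcon
  rw [not_le] at hcon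
  set x := R.x k ω
  set d := R.d k ω
  obtain ⟨hα0, hαle⟩ := hR.alpha_mem k ω
  obtain ⟨hdκ, hdβ⟩ := hR.linPhi_d_le_and k ω
  have hκ0 := P.kappa_nonneg x (R.sigma P A k ω)
  obtain ⟨hd1, hd2⟩ := (P.linPhi_le_iff hκ0).1 hdκ
  have hφ : P.phi x ≤ G / c * δ := by
    have hle : P.phi x ≤ P.kappa x (R.sigma P A k ω) + G * δ := by
      refine (P.phi_le_iff (by positivity)).2 ⟨fun i => ?_, fun j => ?_⟩
      · have e1 : |⟪∇ (P.h i) x, d⟫| ≤ G * δ := (abs_real_inner_le_norm _ _).trans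
          (mul_le_mul (hGh i) hcon.le (norm_nonneg _) hG)
        have e1 := abs_le.1 e1
        have e2 := abs_le.1 (hd1 i)
        rw [abs_le]
        constructor <;> linarith
      · have e1 : |⟪∇ (P.c j) x, d⟫| ≤ G * δ := (abs_real_inner_le_norm _ _).trans
          (mul_le_mul (hGc j) hcon.le (norm_nonneg _) hG)
        have e1 := abs_le.1 e1
        linarith [hd2 j]
    have : c * P.phi x ≤ G * δ := hcφ.trans (by
      change P.phi x - P.kappa x (R.sigma P A k ω) ≤ _
      linarith)
    rw [div_mul_eq_mul_div, le_div_iff₀ hc]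
    linarith
  have hχ : P.chi A.βl x ≤ C * δ := by
    refine P.chi_le hβ.le fun t ht1 ht2 ht3 => ?_
    have htn : ‖t‖ ≤ T :=
      (norm_le_supNorm t).trans (mul_le_mul_of_nonneg_left ht3 (Real.sqrt_nonneg _))
    -- The radius β_l/2 in `chi` leaves room for d, itself of sup norm at most β_l/2, inside the
    -- trust region.
    have hfeas : d + δ • t ∈ R.qpSet P A k ω := by
      refine (P.mem_qpFeasible_iff hκ0).2 ⟨(P.linPhi_le_iff hκ0).2 ⟨fun i => ?_, fun j => ?_⟩, ?_⟩
      · rw [inner_add_right, inner_smul_right, ht1 i, mul_zero, add_zero]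
        exact hd1 i
      · rw [inner_add_right, inner_smul_right]
        have := mul_nonpos_of_nonneg_of_nonpos hδ0.le (ht2 j)
        linarith [hd2 j]
      · have e1 := supNorm_add_le d (δ • t)
        rw [supNorm_smul, abs_of_pos hδ0] at e1
        have e2 : δ * supNorm t ≤ 1 * (A.βl / 2) :=
          mul_le_mul hδ1 ht3 (supNorm_nonneg t) zero_le_one
        have e3 := supNorm_le_norm d
        linarith [(hR.β_mem k ω).1]
    have hmin : R.qpObj k ω d ≤ R.qpObj k ω (d + δ • t) := hR.d_min k ω hfeas
    rw [qpObj, qpObj, inner_add_right, inner_smul_right] at hmin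
    have hn : ‖d + δ • t‖ ≤ δ * (1 + T) := by
      refine (norm_add_le _ _).trans ?_
      rw [norm_smul, Real.norm_of_nonneg hδ0.le]
      have := mul_le_mul_of_nonneg_left htn hδ0.le
      linarith
    have hQ1 : quadForm (R.H k ω) (d + δ • t) ≤ MH * (δ * (1 + T)) ^ 2 :=
      (hH _).2.trans (mul_le_mul_of_nonneg_left (pow_le_pow_left₀ (norm_nonneg _) hn 2) hMH.le)
    have hQ2 : 0 ≤ quadForm (R.H k ω) d := le_trans (by positivity) (hH d).1
    -- Optimality of d against d + δt; both sides are divided by δ afterwards, and the accuracy of g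
    -- then replaces it by the true gradient.
    have e1 : δ * -⟪R.g k ω, t⟫ ≤ δ * (MH * (1 + T) ^ 2 / 2 * δ) := by nlinarith
    have e2 := le_of_mul_le_mul_left e1 hδ0
    have e3 : ⟪R.g k ω, t⟫ - ⟪∇ P.f x, t⟫ ≤ κg * A.αmax * δ * T := by
      rw [← inner_sub_left]
      refine (real_inner_le_norm _ _).trans (mul_le_mul ?_ htn (norm_nonneg _) (by positivity))
      refine le_trans hI ?_
      gcongr
    rw [hC]
    linarith
  have hφ0 := P.phi_nonneg x
  have hχ0 := P.chi_nonneg A.βl hβ.le x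
  have e1 : P.phi x ^ 2 ≤ (G / c) ^ 2 * δ := by
    calc P.phi x ^ 2 ≤ (G / c * δ) ^ 2 := pow_le_pow_left₀ hφ0 hφ 2
      _ = (G / c) ^ 2 * (δ * δ) := by ring
      _ ≤ (G / c) ^ 2 * (1 * δ) := by gcongr
      _ = _ := by ring
  have e2 : P.chi A.βl x ^ 2 ≤ C ^ 2 * δ := by
    calc P.chi A.βl x ^ 2 ≤ (C * δ) ^ 2 := pow_le_pow_left₀ hχ0 hχ 2
      _ = C ^ 2 * (δ * δ) := by ring
      _ ≤ C ^ 2 * (1 * δ) := by gcongr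
      _ = _ := by ring
  have : R.optMeasure P A k ω = P.phi x ^ 2 + P.chi A.βl x ^ 2 := rfl
  linarith

end IsGenerated

end Run

end StochSQP

/-! ### Step-size dynamics and the pathwise contradiction. -/

namespace StochSQP

namespace Run

variable {n m₁ m₂ : ℕ} {S : Type*} {R : Run n S} {P : Problem n m₁ m₂} {A : Params} {x₀ : Vec n}
  [MeasurableSpace S]

namespace IsGenerated

/-- If accurate iterations with step size below `a` are eventually successful, and accurate
iterations outnumber the others, then the step size does not stay below `a`. -/
lemma frequently_le_alpha (hR : R.IsGenerated P A x₀) {ω : S} {G : ℕ → Set S} {a : ℝ}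
    (haγ : A.γ * a ≤ A.αmax)
    (hsucc : ∀ᶠ k in atTop, ω ∈ G k → R.α k ω ≤ a → R.Success P A k ω)
    (hwalk : ¬ BddAbove (Set.range fun N : ℕ =>
      ∑ k ∈ Finset.range N, ((G k).indicator (fun _ => (1 : ℝ)) ω - 1 / 2))) :
    ∃ᶠ k in atTop, a ≤ R.α k ω := by
  by_contra hcon
  rw [not_frequently] at hcon
  obtain ⟨K, hK⟩ := eventually_atTop.1 (hcon.and hsucc)
  have hγ := A.γ_gt
  have hγ0 : 0 < A.γ := by linarith
  set s : ℕ → ℝ := fun k => (G k).indicator (fun _ => (1 : ℝ)) ω - 1 / 2 with hs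
  -- The walk moves by ±1/2 and log_γ α by ±1, hence the factor 2. Since γa ≤ α_max, the cap is
  -- inactive below a.
  have hstep : ∀ k ≥ K, Real.logb A.γ (R.α k ω) + 2 * s k ≤ Real.logb A.γ (R.α (k + 1) ω) := by
    intro k hk
    obtain ⟨h1, h2⟩ := hK k hk
    obtain ⟨h0, -⟩ := hR.alpha_mem k ω
    rw [not_le] at h1
    by_cases hG : ω ∈ G k
    · have h3 : R.α (k + 1) ω = A.γ * R.α k ω := by
        rw [(hR.success k ω (h2 hG h1.le)).2, min_eq_left]
        exact (mul_le_mul_of_nonneg_left h1.le hγ0.le).trans haγ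
      rw [h3, Real.logb_mul hγ0.ne' h0.ne', Real.logb_self_eq_one hγ]
      simp only [hs, hG, Set.indicator_of_mem]
      linarith
    · have h3 := Real.logb_le_logb_of_le hγ (mul_pos (inv_pos.2 hγ0) h0)
        (hR.inv_mul_alpha_le k ω)
      rw [Real.logb_mul (inv_pos.2 hγ0).ne' h0.ne', Real.logb_inv,
        Real.logb_self_eq_one hγ] at h3
      simp only [hs, hG, Set.indicator_of_notMem, not_false_eq_true]
      linarith
  have hsum : ∀ N ≥ K, Real.logb A.γ (R.α K ω) + 2 * (∑ k ∈ Finset.range N, s k -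
      ∑ k ∈ Finset.range K, s k) ≤ Real.logb A.γ (R.α N ω) := by
    intro N hN
    induction N, hN using Nat.le_induction with
    | base => simp
    | succ N hN ih =>
      rw [Finset.sum_range_succ]
      linarith [hstep N hN]
  refine hwalk (IsBoundedUnder.bddAbove_range (isBoundedUnder_of_eventually_le
    (a := (Real.logb A.γ A.αmax - Real.logb A.γ (R.α K ω)) / 2 + ∑ k ∈ Finset.range K, s k) ?_))
  filter_upwards [eventually_ge_atTop K] with N hN
  have h1 := hsum N hN
  have h2 := Real.logb_le_logb_of_le hγ (hR.alpha_mem N ω).1 (hR.alpha_mem N ω).2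
  change ∑ k ∈ Finset.range N, s k ≤ _
  linarith

/-- A long run of accurate iterations, started with step size at least `b`, is impossible while the
search directions stay away from zero: the merit function would drop below its lower bound. -/
lemma exists_run_length (hR : R.IsGenerated P A x₀) {ω : S} {G : ℕ → Set S} {a b r D M : ℝ}
    (hb : 0 < b) (hba : b ≤ a) (hD : 0 < D) {K : ℕ}
    (hsucc : ∀ k ≥ K, ω ∈ G k → R.α k ω ≤ a → R.Success P A k ω)
    (hdec : ∀ k ≥ K, ω ∈ G k → R.Success P A k ω →
      P.f (R.x (k + 1) ω) + r * P.phi (R.x (k + 1) ω) ≤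
        P.f (R.x k ω) + r * P.phi (R.x k ω) - D * R.α k ω)
    (hM : ∀ k, |P.f (R.x k ω) + r * P.phi (R.x k ω)| ≤ M) :
    ∃ N : ℕ, ∀ k ≥ K, b ≤ R.α k ω → ¬ ∀ i < N, ω ∈ G (k + i) := by
  have hγ := A.γ_gt
  have hγ0 : 0 < A.γ := by linarith
  set b' := A.γ⁻¹ * b with hb'
  have hb'0 : 0 < b' := mul_pos (inv_pos.2 hγ0) hb
  have hb'b : b' ≤ b := mul_le_of_le_one_left hb.le (inv_le_one_of_one_le₀ hγ.le)
  set V : ℕ → ℝ := fun k => P.f (R.x k ω) + r * P.phi (R.x k ω) with hV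
  set E := D * b' with hE
  have hE0 : 0 < E := mul_pos hD hb'0
  -- N exceeds the total possible variation of the potential (2/E)V + log_γ α, which drops by at
  -- least 1 per iteration of the run: a success lowers the first term by 2 and raises the second by
  -- at most 1, a failure only lowers the second by 1.
  obtain ⟨N, hN⟩ := exists_nat_gt
    (2 / E * (2 * M) + (Real.logb A.γ A.αmax - Real.logb A.γ b'))
  refine ⟨N, fun k hk hbk hrun => ?_⟩
  have key : ∀ i ≤ N, b' ≤ R.α (k + i) ω ∧
      2 / E * V (k + i) + Real.logb A.γ (R.α (k + i) ω) ≤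
        2 / E * V k + Real.logb A.γ (R.α k ω) - i := by
    intro i
    induction i with
    | zero => intro _; simpa using hb'b.trans hbk
    | succ i ih =>
      intro hi
      obtain ⟨h1, h2⟩ := ih (by omega)
      have hg := hrun i (by omega)
      obtain ⟨hα0, hαm⟩ := hR.alpha_mem (k + i) ω
      rw [← add_assoc]
      push_cast
      by_cases hs : R.Success P A (k + i) ω
      · have hα := (hR.success _ ω hs).2
        refine ⟨?_, ?_⟩
        · rw [hα]
          exact h1.trans (le_min (le_mul_of_one_le_left hα0.le hγ.le) hαm)
        · have h3 := hdec (k + i) (by omega) hg hs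
          have h4 : V (k + i + 1) ≤ V (k + i) - E :=
            h3.trans (sub_le_sub_left (mul_le_mul_of_nonneg_left h1 hD.le) _)
          have h5 : 2 / E * V (k + i + 1) ≤ 2 / E * V (k + i) - 2 := by
            have := mul_le_mul_of_nonneg_left h4 (div_nonneg zero_le_two hE0.le)
            rwa [mul_sub, div_mul_cancel₀ _ hE0.ne'] at this
          have h6 : Real.logb A.γ (R.α (k + i + 1) ω) ≤ 1 + Real.logb A.γ (R.α (k + i) ω) := by
            rw [← Real.logb_self_eq_one hγ, ← Real.logb_mul hγ0.ne' hα0.ne']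
            refine Real.logb_le_logb_of_le hγ (hR.alpha_mem _ ω).1 ?_
            rw [hα]; exact min_le_left _ _
          linarith
      · obtain ⟨hx, hα⟩ := hR.failure _ ω hs
        -- A good iteration fails only above a ≥ b, so one division by γ keeps α ≥ b'.
        have ha : a < R.α (k + i) ω := by
          by_contra hcon
          exact hs (hsucc _ (by omega) hg (not_lt.1 hcon))
        refine ⟨?_, ?_⟩
        · rw [hα, hb']
          exact mul_le_mul_of_nonneg_left (hba.trans ha.le) (inv_pos.2 hγ0).le
        · rw [hα, Real.logb_mul (inv_pos.2 hγ0).ne' hα0.ne', Real.logb_inv,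
            Real.logb_self_eq_one hγ, show V (k + i + 1) = V (k + i) by simp only [hV, hx]]
          linarith
  obtain ⟨h1, h2⟩ := key N le_rfl
  have h3 := Real.logb_le_logb_of_le hγ hb'0 h1
  have h4 := Real.logb_le_logb_of_le hγ (hR.alpha_mem k ω).1 (hR.alpha_mem k ω).2
  have h5 : 2 / E * (V k - V (k + N)) ≤ 2 / E * (2 * M) := by
    refine mul_le_mul_of_nonneg_left ?_ (div_nonneg zero_le_two hE0.le)
    linarith [(abs_le.1 (hM k)).2, (abs_le.1 (hM (k + N))).1]
  rw [mul_sub] at h5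
  linarith

/-- The pathwise part of the convergence theorem. -/
lemma frequently_optMeasure_lt (hR : R.IsGenerated P A x₀) {μ : Measure S} {Om : Set (Vec n)}
    {Lf : ℝ} {Lh : Fin m₁ → ℝ} {Lc : Fin m₂ → ℝ} {ξ MH : ℝ}
    (h1 : R.Regular P μ Om Lf Lh Lc ξ MH) {κg εf : ℝ} (hκg : 0 < κg) (hεf : 0 < εf)
    (hε : εf < ξ * A.θ / (4 * A.αmax)) {ω : S}
    (hmem : ∀ k, ∀ α ∈ Set.Icc 0 (R.α k ω), R.x k ω + α • R.d k ω ∈ Om)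
    (hH : ∀ k, ∀ d : Vec n,
      2 * ξ * ‖d‖ ^ 2 ≤ quadForm (R.H k ω) d ∧ quadForm (R.H k ω) d ≤ MH * ‖d‖ ^ 2)
    (hcl : ∀ y : Vec n, MapClusterPt y atTop (fun k => R.x k ω) → P.EMFCQ y)
    (hwalk : ¬ BddAbove (Set.range fun N : ℕ => ∑ k ∈ Finset.range N,
      ((R.gradAcc P κg k ∩ R.funAcc P εf k).indicator (fun _ => (1 : ℝ)) ω - 1 / 2)))
    (hrun : ∀ m N : ℕ, (∃ᶠ k in atTop, 1 / ((m : ℝ) + 1) ≤ R.α k ω) →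
      ∃ᶠ k in atTop, 1 / ((m : ℝ) + 1) ≤ R.α k ω ∧
        ∀ i < N, ω ∈ R.gradAcc P κg (k + i) ∩ R.funAcc P εf (k + i))
    (hbd : BddAbove (Set.range fun k => ‖R.g k ω‖) ∨ BddAbove (Set.range fun k => R.ρ k ω))
    {ε : ℝ} (hε0 : 0 < ε) :
    ∃ᶠ k in atTop, R.optMeasure P A k ω < ε := by
  have hOm : IsCompact Om := Metric.isCompact_of_isClosed_isBounded h1.closed h1.bounded
  have hx : ∀ k, R.x k ω ∈ Om := fun k => by
    simpa using hmem k 0 ⟨le_rfl, (hR.alpha_mem k ω).1.le⟩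
  have hφc := P.continuous_phi h1.h_smooth h1.c_smooth
  obtain ⟨c, hc0, hc⟩ := P.exists_le_deltaPhi_of_mapClusterPt h1.h_smooth h1.c_smooth A.σu_pos
    A.κu_pos hOm hx hcl
  obtain ⟨C, hC⟩ : ∃ C, ∀ᶠ k in atTop, ¬ R.PenaltyOk P A k ω → R.ρ k ω ≤ C := by
    rcases hbd with ⟨Gb, hGb⟩ | ⟨C, hC⟩
    · obtain ⟨Φ, hΦ⟩ := hOm.bddAbove_image hφc.continuousOn
      exact ⟨_, hc.mono fun k hk => hR.rho_le_of_not_penaltyOk (fun d => (hH k d).2) h1.MH_pos.le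
        hc0 hk (hGb ⟨k, rfl⟩) (hΦ ⟨_, hx k, rfl⟩)⟩
    · exact ⟨C, Eventually.of_forall fun k _ => hC ⟨k, rfl⟩⟩
  by_contra hcon
  rw [not_frequently] at hcon
  obtain ⟨K, hK⟩ := eventually_atTop.1 ((hR.eventually_penaltyOk hC).and (hc.and hcon))
  set r := R.ρ K ω with hr
  have hρ : ∀ k ≥ K, R.ρ k ω = r := fun k hk => by
    induction k, hk using Nat.le_induction with
    | base => rfl
    | succ k hk ih => rw [hR.penalty_keep k ω (hK k hk).1, ih]
  obtain ⟨G, hG0, hG⟩ : ∃ G, 0 ≤ G ∧ ∀ k, (∀ i, ‖∇ (P.h i) (R.x k ω)‖ ≤ G) ∧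
      ∀ j, ‖∇ (P.c j) (R.x k ω)‖ ≤ G := by
    have hb : Continuous fun x => ∑ i, ‖∇ (P.h i) x‖ + ∑ j, ‖∇ (P.c j) x‖ :=
      (continuous_finsetSum _ fun i _ => (continuous_gradient (h1.h_smooth i)).norm).add
        (continuous_finsetSum _ fun j _ => (continuous_gradient (h1.c_smooth j)).norm)
    obtain ⟨G, hG⟩ := hOm.bddAbove_image hb.continuousOn
    have hG' : ∀ k, ∑ i, ‖∇ (P.h i) (R.x k ω)‖ + ∑ j, ‖∇ (P.c j) (R.x k ω)‖ ≤ G :=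
      fun k => hG ⟨_, hx k, rfl⟩
    have n1 : ∀ k, 0 ≤ ∑ i, ‖∇ (P.h i) (R.x k ω)‖ := fun k =>
      Finset.sum_nonneg fun _ _ => norm_nonneg _
    have n2 : ∀ k, 0 ≤ ∑ j, ‖∇ (P.c j) (R.x k ω)‖ := fun k =>
      Finset.sum_nonneg fun _ _ => norm_nonneg _
    refine ⟨G, by linarith [hG' 0, n1 0, n2 0], fun k => ⟨fun i => ?_, fun j => ?_⟩⟩
    · have := Finset.single_le_sum (f := fun i => ‖∇ (P.h i) (R.x k ω)‖)
        (fun _ _ => norm_nonneg _) (Finset.mem_univ i)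
      linarith [hG' k, n2 k]
    · have := Finset.single_le_sum (f := fun j => ‖∇ (P.c j) (R.x k ω)‖)
        (fun _ _ => norm_nonneg _) (Finset.mem_univ j)
      linarith [hG' k, n1 k]
  obtain ⟨δ, hδ0, hδ⟩ := hR.exists_le_norm_d (P := P) (c := c) hκg h1.ξ_pos h1.MH_pos hc0 hG0 hε0
  obtain ⟨a, ⟨ha1, haγ, haC⟩, ha0⟩ : ∃ a : ℝ, (a * 1 ≤ 1 ∧ a * A.γ ≤ A.αmax ∧
      a * (κg + |Lf| + 2 * εf + r * (∑ i, |Lh i| + ∑ j, |Lc j|)) ≤ (1 - A.θ) * ξ) ∧ 0 < a :=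
    (((eventually_mul_le 1 one_pos).and ((eventually_mul_le _ A.αmax_pos).and
      (eventually_mul_le _ (mul_pos (sub_pos.2 A.θ_lt) h1.ξ_pos)))).and
        self_mem_nhdsWithin).exists
  have hsucc : ∀ k ≥ K, ω ∈ R.gradAcc P κg k ∩ R.funAcc P εf k → R.α k ω ≤ a →
      R.Success P A k ω := by
    intro k hk hg hα
    refine hR.success_of_good h1 (hmem k) (fun d => (hH k d).1) (hK k hk).1 hg.1 hg.2
      (by linarith) (le_trans (mul_le_mul_of_nonneg_right hα ?_) (by rw [hρ k hk]; exact haC))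
    have e1 : 0 ≤ ∑ i, |Lh i| := Finset.sum_nonneg fun _ _ => abs_nonneg _
    have e2 : 0 ≤ ∑ j, |Lc j| := Finset.sum_nonneg fun _ _ => abs_nonneg _
    have e3 : 0 ≤ R.ρ k ω := A.ρ0_pos.le.trans (hR.rho0_le k ω)
    positivity
  -- The threshold a depends on the path; passing to 1/(m + 1) leaves only countably many almost
  -- sure statements.
  obtain ⟨m, hm⟩ := exists_nat_one_div_lt ha0
  have hfreq : ∃ᶠ k in atTop, 1 / ((m : ℝ) + 1) ≤ R.α k ω :=
    (hR.frequently_le_alpha (a := a) (by linarith) (eventually_atTop.2 ⟨K, hsucc⟩) hwalk).mono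
      fun k hk => hm.le.trans hk
  obtain ⟨M, hM⟩ := hOm.exists_bound_of_continuousOn (f := fun x => P.f x + r * P.phi x)
    (h1.f_smooth.continuous.add (continuous_const.mul hφc)).continuousOn
  have hθξ : 0 < ξ * A.θ / 2 := by
    have := h1.ξ_pos
    have := A.θ_pos
    positivity
  obtain ⟨N, hN⟩ := hR.exists_run_length (r := r) (D := ξ * A.θ / 2 * δ ^ 2) (M := M) (K := K)
    (Nat.one_div_pos_of_nat (α := ℝ) (n := m)) hm.le (by positivity) hsucc
    (fun k hk hg hs => by
      have e1 := hR.merit_decrease (fun d => (hH k d).1) (hK k hk).1 hε hεf hg.2 hs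
      rw [hρ k hk] at e1
      have e2 := hδ k ω (hH k) (hG k).1 (hG k).2 (hK k hk).2.1 hg.1 (not_lt.1 (hK k hk).2.2)
      have e3 := pow_le_pow_left₀ hδ0.le e2 2
      have e4 := mul_le_mul_of_nonneg_left e3 (mul_nonneg hθξ.le (hR.alpha_mem k ω).1.le)
      linarith)
    (fun k => hM _ (hx k))
  obtain ⟨k, ⟨hk1, hk2⟩, hk3⟩ :=
    ((hrun m N hfreq).and_eventually (eventually_ge_atTop K)).exists
  exact hN k hk3 hk1 hk2

end IsGenerated

end Run

end StochSQP

/-! ### Almost sure convergence. -/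

theorem mainTheorem1 {n m₁ m₂ : ℕ} (P : StochSQP.Problem n m₁ m₂) (A : StochSQP.Params)
    (x₀ : StochSQP.Vec n)
    {S : Type*} [MeasurableSpace S] (μ : Measure S) [IsProbabilityMeasure μ]
    (R : StochSQP.Run n S) (hR : R.IsGenerated P A x₀)
    (Om : Set (StochSQP.Vec n)) (Lf : ℝ) (Lh : Fin m₁ → ℝ) (Lc : Fin m₂ → ℝ) (ξ MH : ℝ)
    (h1 : R.Regular P μ Om Lf Lh Lc ξ MH)
    (κg εf : ℝ) (hκg : 0 < κg) (hεf : 0 < εf)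
    (h2 : R.ProbAccurate P A μ κg εf)
    (hp : 1 / 2 < A.pf * A.pg0)
    (hε : εf < ξ * A.θ / (4 * A.αmax))
    (h3 : R.EMFCQAtAccPts P μ)
    (κf : ℝ) (hκf : 0 < κf)
    (h4 : R.VarianceCond P A μ κf) :
    ∀ᵐ ω ∂μ,
      (BddAbove (Set.range fun k => ‖R.g k ω‖) ∨ BddAbove (Set.range fun k => R.ρ k ω)) →
        liminf (fun k => ((R.optMeasure P A k ω : ℝ) : EReal)) atTop = 0 := by
  have hf := h1.f_smooth
  have hh := h1.h_smooth
  have hc := h1.c_smooth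
  have hG : ∀ k, MeasurableSet[hR.filtration (k + 1)]
      (R.gradAcc P κg k ∩ R.funAcc P εf k) := fun k =>
    (R.halfPast_le_past_succ k _ (hR.measurableSet_gradAcc hf hh hc κg k)).inter
      (hR.measurableSet_funAcc hf hh hc εf k)
  have hcond := hR.ae_le_condExp_good hf hh hc h2
  have hwalk := StochSQP.ae_not_bddAbove_sum_indicator (ℱ := hR.filtration) hG hp hcond
  have hrun : ∀ᵐ ω ∂μ, ∀ m N : ℕ, (∃ᶠ k in atTop, 1 / ((m : ℝ) + 1) ≤ R.α k ω) →
      ∃ᶠ k in atTop, 1 / ((m : ℝ) + 1) ≤ R.α k ω ∧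
        ∀ i < N, ω ∈ R.gradAcc P κg (k + i) ∩ R.funAcc P εf (k + i) := by
    refine ae_all_iff.2 fun m => ae_all_iff.2 fun N => ?_
    have hB : ∀ k, MeasurableSet[hR.filtration k] (R.α k ⁻¹' Set.Ici (1 / ((m : ℝ) + 1))) :=
      fun k => (hR.measurable_past hh hc k).2.1 measurableSet_Ici
    exact StochSQP.ae_frequently_run N hB hG (by linarith) hcond
  filter_upwards [hwalk, hrun, h1.mem, h1.H_bdd, h3] with ω hω1 hω2 hω3 hω4 hω5 hbd
  have hpos : ∀ k, 0 ≤ R.optMeasure P A k ω := fun k => add_nonneg (sq_nonneg _) (sq_nonneg _)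
  refine le_antisymm ?_ ?_
  · refine EReal.le_of_forall_lt_iff_le.1 fun ε hε0 => ?_
    refine liminf_le_of_frequently_le' ?_
    have hε' : (0 : ℝ) < ε := by exact_mod_cast hε0
    exact (hR.frequently_optMeasure_lt h1 hκg hεf hε hω3 hω4 hω5 hω1 hω2 hbd hε').mono
      fun k hk => by exact_mod_cast hk.le
  · exact le_liminf_of_le (by isBoundedDefault) (Eventually.of_forall fun k => by
      exact_mod_cast hpos k)
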